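/- Setting. Let $d$ be a dimension ($d\ge 1$; the one-site case $d=0$ is also allowed), $m>0$, $0<\zeta<2$, and put $\omega^2=m^2+2d$, $t=\zeta/\omega^2$. On the periodic lattice $\mathbb Z_L^d$ with $L\ge 2$ consider the free field with action $S[\phi]=\frac12\sum_x\{-\phi_x\Delta\phi_x+m^2\phi_x^2\}$, where $\Delta\phi_x=\sum_\mu(\phi_{x+e_\mu}-2\phi_x+\phi_{x-e_\mu})$, and equilibrium law proportional to $e^{-S[\phi]}d\phi$. The local update of the site $z$ is $\phi\mapsto M_z\phi+P_z\pi$, where $$(M_z)_{x,y}=\delta_{x,y}+\delta_{x,z}\Bigl[-\zeta\delta_{x,y}+\tfrac{\zeta}{\omega^2}\sum_{\mu=1}^d(\delta_{x+e_\mu,y}+\delta_{x-e_\mu,y})\Bigr],\qquad (P_z)_{x,y}=\delta_{x,y}\delta_{x,z}\tfrac{\sqrt{\zeta(2-\zeta)}}{\omega},$$ and the $\pi_x$ are independent standard normal variables. A lexicographic sweep with starting corner $b$ is an ordering $x_1,\dots,x_{L^d}$ of all sites in which $x-e_\mu$ precedes $x$ whenever $x_\mu\ne b_\mu$. Its update is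 $\phi\mapsto M\phi+P\pi$ with $M=M_{x_{L^d}}\cdots M_{x_1}$ and $P=\sum_i M_{x_{L^d}}\cdots M_{x_{i+1}}P_{x_i}$. For $a\in\mathbb Z_L^d$ let $M^{(a)},P^{(a)}$ be the matrices of the translated sweep $x_1+a,\dots,x_{L^d}+a$. In the randomized algorithm, before each sweep $a$ is drawn afresh, uniformly on $\mathbb Z_L^d$, and $\phi'=M^{(a)}\phi+P^{(a)}\pi$ with fresh $\pi$. Fourier components are $\phi_p=L^{-d/2}\sum_x\phi_xe^{-2\pi ip\cdot x/L}$, and matrix entries with indices $p,q,r,s$ are taken in this orthonormal momentum basis. Stars on matrices denote entrywise complex conjugation, $A^*\cdot A$ is the Hadamard product, and $\|A\|=\max_p\sum_q|A_{p,q}|$. Finally, $M^D$ is the diagonal matrix $$M^D_{p,q}=\delta_{p,q}\,\frac{1-\zeta+t\sum_\mu e^{2\pi ip_\mu/L}}{1-t\sum_\mu e^{-2\pi ip_\mu/L}} .$$ Claim. (1) For every $L\ge2$ and every lexicographic sweep, averaging over $a$ and $\pi$ gives $$\langle{\phi'}_p^*\phi'_q\rangle=\sum_{r,s}\bar M^Q_{pq,rs}\,\phi_r^*\phi_s+\frac1{L^d}\sum_a\sum_r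 (P^{(a)}_{p,r})^*P^{(a)}_{q,r},\qquad \bar M^Q=\frac1{L^d}\sum_a (M^{(a)})^*\otimes M^{(a)},$$ and $\bar M^Q_{pq,rs}=M^*_{p,r}M_{q,s}\,\delta_{p-q,r-s}$. In particular the block of $\bar M^Q$ in the sector $p=q$ (the basis $\phi_p^*\phi_p$) is the Hadamard product $M^*\cdot M$. (2) For every $L\ge2$ and every lexicographic sweep, $1-M^*\cdot M$ and $1-{M^D}^*\cdot M^D$ are invertible. Let $A_{\mathcal M^2}=\sum_{t\ge1}C(t)$ be the integrated autocorrelation of the squared magnetization $\mathcal M^2=(L^{-d/2}\sum_x\phi_x)^2$, where $C(t)$ is the normalized connected autocorrelation after $t$ randomized sweeps started in equilibrium. This series converges, and $$1+A_{\mathcal M^2}=\bigl[(1-M^*\cdot M)^{-1}\bigr]_{0,0},\qquad \bigl[(1-{M^D}^*\cdot M^D)^{-1}\bigr]_{0,0}=\frac{(m^2+2d-d\zeta)^2}{\zeta(2-\zeta)m^2(m^2+2d)} .$$ (3) There are constants $C$ and $L_0$, depending only on $d,m,\zeta$, such that for all $L\ge L_0$ and all lexicographic sweeps $$\bigl\|(1-M^*\cdot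 M)^{-1}-(1-{M^D}^*\cdot M^D)^{-1}\bigr\|\le \frac CL .$$ (4) Consequently, for any choice of a lexicographic sweep for each $L$, $$1+A_{\mathcal M^2}\longrightarrow\frac{(m^2+2d-d\zeta)^2}{\zeta(2-\zeta)m^2(m^2+2d)}\qquad(L\to\infty).$$ -/

import Mathlib

open Matrix MeasureTheory ProbabilityTheory Filter Topology ComplexConjugate

/-! The norm on complex matrices is the maximum absolute row sum, `max_p ∑_q |A p q|`. -/
attribute [local instance] Matrix.linftyOpNormedAddCommGroup

noncomputable section

namespace LHMC

/-- The periodic lattice `ℤ_L^d`; it indexes both sites and momenta. -/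
abbrev Site (d L : ℕ) : Type := Fin d → ZMod L

/-- Real scalar field configurations (also used for the fictitious momenta). -/
abbrev Field (d L : ℕ) : Type := Site d L → ℝ

/-- The unit lattice vector in direction `μ`. -/
def unitVec (d L : ℕ) (μ : Fin d) : Site d L := Pi.single μ 1

section FreeField

variable {d L : ℕ} [NeZero L]

/-- The lattice Laplacian. -/
def laplacian (φ : Field d L) (x : Site d L) : ℝ :=
  ∑ μ : Fin d, (φ (x + unitVec d L μ) - 2 * φ x + φ (x - unitVec d L μ))

/-- The free action `S[φ] = ½ ∑_x (-φ_x Δφ_x + m² φ_x²)`. -/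
def action (m : ℝ) (φ : Field d L) : ℝ :=
  (1 / 2) * ∑ x : Site d L, (-(φ x) * laplacian φ x + m ^ 2 * φ x ^ 2)

/-- The equilibrium probability measure `e^{-S[φ]} dφ / Z` of the free field theory. -/
def equilibrium (d L : ℕ) [NeZero L] (m : ℝ) : Measure (Field d L) :=
  (volume : Measure (Field d L)).tilted (fun φ => -action m φ)

/-- The law of the fictitious momenta: independent standard normal variables. -/
def momentumLaw (d L : ℕ) [NeZero L] : Measure (Field d L) :=
  Measure.pi (fun _ : Site d L => gaussianReal 0 1)

/-- The magnetization `L^{-d/2} ∑_x φ_x`. -/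
def magnetization (φ : Field d L) : ℝ :=
  (Real.sqrt ((L : ℝ) ^ d))⁻¹ * ∑ x : Site d L, φ x

end FreeField

section Updates

variable {d L : ℕ} [NeZero L]

/-- The squared single-site frequency `m² + 2d`. -/
def siteFreqSq (d : ℕ) (m : ℝ) : ℝ := m ^ 2 + 2 * d

/-- The matrix `M_z` of the local update `φ ↦ M_z φ + P_z π` of the site `z`, with mass `m` and
overrelaxation parameter `ζ`. -/
def localM (m ζ : ℝ) (z : Site d L) : Matrix (Site d L) (Site d L) ℝ :=
  Matrix.of fun x y =>
    (if x = y then 1 else 0) + (if x = z then 1 else 0) *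
      (-ζ * (if x = y then 1 else 0) + ζ / siteFreqSq d m * ∑ μ : Fin d,
        ((if x + unitVec d L μ = y then 1 else 0) + (if x - unitVec d L μ = y then 1 else 0)))

/-- The matrix `P_z` of the local update `φ ↦ M_z φ + P_z π` of the site `z`. -/
def localP (m ζ : ℝ) (z : Site d L) : Matrix (Site d L) (Site d L) ℝ :=
  Matrix.of fun x y => (if x = y then 1 else 0) * (if x = z then 1 else 0) *
    (Real.sqrt (ζ * (2 - ζ)) / Real.sqrt (siteFreqSq d m))

/-- The matrix `M = M_{x_n} ⋯ M_{x_2} M_{x_1}` of the sweep that updates the sites `x_1, …, x_n`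
in this order. -/
def sweepM (m ζ : ℝ) : List (Site d L) → Matrix (Site d L) (Site d L) ℝ
  | [] => 1
  | x :: xs => sweepM m ζ xs * localM m ζ x

/-- The matrix `P = ∑_i (M_{x_n} ⋯ M_{x_{i+1}}) P_{x_i}` of the sweep that updates the sites
`x_1, …, x_n` in this order, so that the sweep is `φ ↦ M φ + P π`. -/
def sweepP (m ζ : ℝ) : List (Site d L) → Matrix (Site d L) (Site d L) ℝ
  | [] => 0
  | x :: xs => sweepM m ζ xs * localP m ζ x + sweepP m ζ xs

/-- A lexicographic sweep of the periodic lattice starting at the corner `start`: every site is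
updated exactly once, and `x - e_μ` is updated before `x`, except across the boundary
`x_μ = start_μ`. -/
structure IsLexSweep (start : Site d L) (sites : List (Site d L)) : Prop where
  nodup : sites.Nodup
  complete : ∀ x : Site d L, x ∈ sites
  before : ∀ (x : Site d L) (μ : Fin d), x μ ≠ start μ →
    sites.idxOf (x - unitVec d L μ) < sites.idxOf x

/-- The same sweep after the lattice translation by `a`: the sites `x_1 + a, x_2 + a, …`. -/
def translate (a : Site d L) (sites : List (Site d L)) : List (Site d L) :=
  sites.map (fun x => x + a)

end Updates

section Fourier

variable {d L : ℕ} [NeZero L]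

/-- The unitary Fourier matrix `F_{p,x} = L^{-d/2} e^{-2πi p·x/L}`. -/
def dft (d L : ℕ) [NeZero L] : Matrix (Site d L) (Site d L) ℂ :=
  Matrix.of fun p x =>
    ((Real.sqrt ((L : ℝ) ^ d))⁻¹ : ℝ) * ZMod.stdAddChar (-(∑ μ : Fin d, p μ * x μ))

/-- The Fourier transform of a field configuration. -/
def fourier (φ : Field d L) : Site d L → ℂ := dft d L *ᵥ (fun x => (φ x : ℂ))

/-- The momentum space representation `F A F^†` of a matrix given in position space. -/
def momentumRep (A : Matrix (Site d L) (Site d L) ℝ) : Matrix (Site d L) (Site d L) ℂ :=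
  dft d L * A.map (fun r : ℝ => (r : ℂ)) * (dft d L)ᴴ

/-- The sweep matrix `M` in momentum space. -/
def momM (m ζ : ℝ) (sites : List (Site d L)) : Matrix (Site d L) (Site d L) ℂ :=
  momentumRep (sweepM m ζ sites)

/-- The sweep matrix `P` in momentum space. -/
def momP (m ζ : ℝ) (sites : List (Site d L)) : Matrix (Site d L) (Site d L) ℂ :=
  momentumRep (sweepP m ζ sites)

/-- The Hadamard product `A^* · A`, where `*` is entrywise complex conjugation. -/
def absSq (A : Matrix (Site d L) (Site d L) ℂ) : Matrix (Site d L) (Site d L) ℂ :=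
  (A.map conj) ⊙ A

/-- The translation invariant (infinite-volume) update matrix `M^D`: it is diagonal in momentum
space, with entries `(1 - ζ + t ∑_μ e^{2πi p_μ/L}) / (1 - t ∑_μ e^{-2πi p_μ/L})`, where
`t = ζ / (m² + 2d)`. -/
def momMD (d L : ℕ) [NeZero L] (m ζ : ℝ) : Matrix (Site d L) (Site d L) ℂ :=
  Matrix.diagonal fun p =>
    (1 - (ζ : ℂ) + ((ζ / siteFreqSq d m : ℝ) : ℂ) * ∑ μ : Fin d, ZMod.stdAddChar (p μ)) /
      (1 - ((ζ / siteFreqSq d m : ℝ) : ℂ) * ∑ μ : Fin d, ZMod.stdAddChar (-(p μ)))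

/-- The quadratic update matrix in the basis `φ_p^* φ_q`, averaged over the uniformly distributed
translation `a` of the sweep: `L^{-d} ∑_a (M^{(a)})^* ⊗ M^{(a)}`. -/
def avgQuadM (m ζ : ℝ) (sites : List (Site d L)) :
    Matrix (Site d L × Site d L) (Site d L × Site d L) ℂ :=
  ((L : ℂ) ^ d)⁻¹ • ∑ a : Site d L,
    Matrix.kroneckerMap (· * ·)
      ((momM m ζ (translate a sites)).map conj) (momM m ζ (translate a sites))

/-- The averaged inhomogeneous term `L^{-d} ∑_a ∑_r (P^{(a)}_{p,r})^* P^{(a)}_{q,r}` of the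
quadratic update. -/
def avgQuadP (m ζ : ℝ) (sites : List (Site d L)) (p q : Site d L) : ℂ :=
  ((L : ℂ) ^ d)⁻¹ * ∑ a : Site d L, ∑ r : Site d L,
    conj (momP m ζ (translate a sites) p r) * momP m ζ (translate a sites) q r

/-- The block of the averaged quadratic update matrix in the sector `p = q`, that is, in the
basis `φ_p^* φ_p`. -/
def sectorBlock (m ζ : ℝ) (sites : List (Site d L)) : Matrix (Site d L) (Site d L) ℂ :=
  (avgQuadM m ζ sites).submatrix (fun p => (p, p)) (fun p => (p, p))

end Fourier

section Autocorrelation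

variable {d L : ℕ} [NeZero L]

/-- One randomized sweep acting on observables: `f ↦ E[f(φ') | φ]`, where
`φ' = M^{(a)} φ + P^{(a)} π` with a uniform translation `a ∈ ℤ_L^d` and independent standard
normal momenta `π`. -/
def transition {E : Type*} [NormedAddCommGroup E] [NormedSpace ℝ E] (m ζ : ℝ)
    (sites : List (Site d L)) (f : Field d L → E) (φ : Field d L) : E :=
  ((L : ℝ) ^ d)⁻¹ • ∑ a : Site d L,
    ∫ π : Field d L, f (sweepM m ζ (translate a sites) *ᵥ φ + sweepP m ζ (translate a sites) *ᵥ π)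
      ∂(momentumLaw d L)

/-- The normalized connected autocorrelation function, after `t` randomized sweeps started in
equilibrium, of the observable `Ω`. -/
def autocorr (m ζ : ℝ) (sites : List (Site d L)) (Ω : Field d L → ℝ) (t : ℕ) : ℝ :=
  ((∫ φ, (transition m ζ sites)^[t] Ω φ * Ω φ ∂(equilibrium d L m)) -
      (∫ φ, (transition m ζ sites)^[t] Ω φ ∂(equilibrium d L m)) *
        ∫ φ, Ω φ ∂(equilibrium d L m)) /
    ((∫ φ, Ω φ ^ 2 ∂(equilibrium d L m)) - (∫ φ, Ω φ ∂(equilibrium d L m)) ^ 2)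

/-- The observable `𝓜²`, the square of the magnetization. -/
def magSq (φ : Field d L) : ℝ := magnetization φ ^ 2

/-- The integrated autocorrelation of the observable `𝓜²`. -/
def intAutocorr (m ζ : ℝ) (sites : List (Site d L)) : ℝ :=
  ∑' t : ℕ, autocorr m ζ sites magSq (t + 1)

end Autocorrelation

/-- The infinite-volume value of `1 + A_{𝓜²}`. -/
def infiniteVolumeValue (d : ℕ) (m ζ : ℝ) : ℝ :=
  (m ^ 2 + 2 * d - d * ζ) ^ 2 / (ζ * (2 - ζ) * m ^ 2 * (m ^ 2 + 2 * d))

end LHMC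

end

/-! Write t = ζ/ω², σ = `noiseAmp`, and let N = `updatedPart` be the adjacency matrix restricted to
already updated neighbours. The field after a sweep solves a linear system in itself
(`sweep_apply`). With W = 1 - tN, the matrix G = W⁻¹ is therefore the noise matrix divided by σ, and
M = 1 - GK with K = t(-Δ + m²). Since N + Nᵀ is the full adjacency matrix, K = W + W† - (2 - ζ),
which gives σ²GG† + MDM† = D for the free covariance D (`fluctuation_dissipation`). This identity is
used twice. Its diagonal shows that the nonnegative matrix |M_pq|² strictly decreases the positive
vector D_p, so its Neumann series converges. Sandwiched between X and X†, it bounds G in ℓ² by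
1/(σm), uniformly in L.

In M^D the matrix N is replaced by the backward-neighbour matrix, which is diagonal in momentum
space. The difference B = `boundaryPart` lives on the links crossing the starting hyperplanes, a
fraction O(1/L) of all links. In momentum space its entries are O(1/L), and its rows and columns
have ℓ² norm O(L^{-1/2}). Put E = M - M^D. Then | |M|² - |M^D|² | ≤ |E|² + 2|M^D||E| entrywise. The
square turns the ℓ² bound on rows of E into a row sum O(1/L). The cross term survives only on the
diagonal, where one more resolvent expansion gives E_pp = O(1/L) (`norm_absSq_sub_le`). The uniform
bound on (1 - |M^D|²)⁻¹ carries the estimate over to the inverses.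

For the autocorrelation, translating the sweep by a multiplies M_pq by e^{2πi(q-p)·a/L}. Averaging
over a keeps only terms conserving momentum differences, so the powers |φ_p|² evolve among
themselves under |M|². In equilibrium only |φ_0|² is correlated with the squared magnetization, by
integration by parts along the constant field. Hence C(t) is the (0,0) entry of the t-th power of
|M|² (`autocorr_magSq`), and summing over t gives the inverse. -/

namespace LHMC

/-! ### Linear equations satisfied by the sweep matrices in position space. -/

section SweepEquations

variable {d L : ℕ} [NeZero L]

/-- The adjacency matrix of the periodic lattice, with multiplicities. -/
noncomputable def adjacency (d L : ℕ) [NeZero L] : Matrix (Site d L) (Site d L) ℝ :=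
  Matrix.of fun x y => ∑ μ : Fin d,
    ((if x + unitVec d L μ = y then 1 else 0) + (if x - unitVec d L μ = y then 1 else 0))

/-- The part of the adjacency matrix that connects a site to its already updated neighbours. -/
noncomputable def updatedPart (sites : List (Site d L)) : Matrix (Site d L) (Site d L) ℝ :=
  Matrix.of fun x y => if sites.idxOf y < sites.idxOf x then adjacency d L x y else 0

/-- The inverse covariance matrix `-Δ + m²` of the free field. -/
noncomputable def invCov (d L : ℕ) [NeZero L] (m : ℝ) : Matrix (Site d L) (Site d L) ℝ :=
  siteFreqSq d m • 1 - adjacency d L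

/-- The amplitude of the noise in a local update. -/
noncomputable def noiseAmp (d : ℕ) (m ζ : ℝ) : ℝ :=
  Real.sqrt (ζ * (2 - ζ)) / Real.sqrt (siteFreqSq d m)

theorem adjacency_comm (x y : Site d L) : adjacency d L x y = adjacency d L y x := by
  simp only [adjacency, Matrix.of_apply]
  refine Finset.sum_congr rfl fun μ _ => ?_
  rw [add_comm]
  congr 2 <;> apply propext
  · constructor <;> rintro rfl <;> simp
  · constructor <;> rintro rfl <;> simp

theorem unitVec_ne_zero (hL : 2 ≤ L) (μ : Fin d) : unitVec d L μ ≠ 0 := by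
  have : Fact (1 < L) := ⟨hL⟩
  intro h
  have := congrFun h μ
  simp [unitVec] at this

theorem adjacency_self (hL : 2 ≤ L) (x : Site d L) : adjacency d L x x = 0 := by
  simp [adjacency, unitVec_ne_zero hL]

theorem localM_mulVec_of_ne (m ζ : ℝ) {x z : Site d L} (h : x ≠ z) (φ : Field d L) :
    (localM m ζ z *ᵥ φ) x = φ x := by
  simp [localM, Matrix.mulVec, dotProduct, h]

theorem localM_mulVec_self (m ζ : ℝ) (z : Site d L) (φ : Field d L) :
    (localM m ζ z *ᵥ φ) z =
      (1 - ζ) * φ z + ζ / siteFreqSq d m * ∑ y, adjacency d L z y * φ y := by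
  simp only [localM, Matrix.mulVec, dotProduct, Matrix.of_apply, adjacency, if_true, one_mul,
    add_mul, Finset.sum_add_distrib, mul_assoc, ← Finset.mul_sum]
  simp
  ring

theorem localP_mulVec (m ζ : ℝ) (x z : Site d L) (π : Field d L) :
    (localP m ζ z *ᵥ π) x = if x = z then noiseAmp d m ζ * π x else 0 := by
  simp [localP, Matrix.mulVec, dotProduct, noiseAmp]

/-- The result of a sweep is determined by the equations of motion of the updated sites, in which
the already updated neighbours enter with their new values. -/
theorem sweep_apply (m ζ : ℝ) (π : Field d L) (l : List (Site d L)) (hl : l.Nodup) :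
    ∀ (φ : Field d L) (x : Site d L),
      (sweepM m ζ l *ᵥ φ + sweepP m ζ l *ᵥ π) x =
        if x ∈ l then (1 - ζ) * φ x + noiseAmp d m ζ * π x + ζ / siteFreqSq d m *
          ∑ y, adjacency d L x y * (if l.idxOf y < l.idxOf x then
            (sweepM m ζ l *ᵥ φ + sweepP m ζ l *ᵥ π) y else φ y)
        else φ x := by
  induction l with
  | nil => intro φ x; simp [sweepM, sweepP]
  | cons z l ih =>
    obtain ⟨hz, hl⟩ := List.nodup_cons.1 hl
    intro φ x
    set φ₁ : Field d L := localM m ζ z *ᵥ φ + localP m ζ z *ᵥ π with hφ₁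
    have hS : sweepM m ζ (z :: l) *ᵥ φ + sweepP m ζ (z :: l) *ᵥ π =
        sweepM m ζ l *ᵥ φ₁ + sweepP m ζ l *ᵥ π := by
      simp only [sweepM, sweepP, hφ₁, Matrix.mulVec_add, Matrix.add_mulVec, Matrix.mulVec_mulVec,
        add_assoc]
    have hne : ∀ y, y ≠ z → φ₁ y = φ y := fun y hy => by
      simp [hφ₁, localM_mulVec_of_ne m ζ hy, localP_mulVec, hy]
    have hself : φ₁ z = (1 - ζ) * φ z + noiseAmp d m ζ * π z +
        ζ / siteFreqSq d m * ∑ y, adjacency d L z y * φ y := by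
      simp only [hφ₁, Pi.add_apply, localM_mulVec_self, localP_mulVec, if_true]; ring
    rw [hS]
    -- The remaining list does not contain z, so the value at z is already final.
    have hSz : (sweepM m ζ l *ᵥ φ₁ + sweepP m ζ l *ᵥ π) z = φ₁ z := by
      rw [ih hl, if_neg hz]
    by_cases hx : x = z
    -- The head has index 0, so all its neighbours enter with their old values.
    · subst hx
      rw [hSz, hself]
      simp
    · rw [ih hl φ₁ x]
      simp only [List.mem_cons, hx, false_or]
      split_ifs with hxl
      · rw [hne x hx]
        congr 2
        refine Finset.sum_congr rfl fun y _ => ?_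
        congr 1
        rw [List.idxOf_cons_ne _ (Ne.symm hx)]
        -- For y = z the two conditionals agree: the tail sees φ₁ z in either branch, and in z :: l
        -- the site z precedes x.
        by_cases hy : y = z
        · subst hy
          rw [hSz]
          simp
        · rw [List.idxOf_cons_ne _ (Ne.symm hy), hne y hy]
          simp
      · exact hne x hx

variable {m ζ : ℝ} {sites : List (Site d L)}

/-- Column by column this is `sweep_apply` with zero field and unit-vector noise; the companion for
`sweepM` exchanges the two roles. -/
theorem one_sub_updatedPart_mul_sweepP (hn : sites.Nodup) (hc : ∀ x, x ∈ sites) :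
    (1 - (ζ / siteFreqSq d m) • updatedPart sites) * sweepP m ζ sites =
      noiseAmp d m ζ • (1 : Matrix (Site d L) (Site d L) ℝ) := by
  refine Matrix.ext_of_mulVec_single fun y => ?_
  ext x
  have h := sweep_apply m ζ (Pi.single y 1) sites hn 0 x
  rw [if_pos (hc x)] at h
  simp only [Matrix.mulVec_zero, zero_add, Pi.zero_apply, mul_zero] at h
  rw [← Matrix.mulVec_mulVec, Matrix.sub_mulVec, Matrix.one_mulVec, Pi.sub_apply, h]
  simp only [Matrix.smul_mulVec, Pi.smul_apply, smul_eq_mul, Matrix.one_mulVec]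
  simp only [Matrix.mulVec, dotProduct, updatedPart, Matrix.of_apply, mul_ite, ite_mul, zero_mul,
    mul_zero]
  ring

theorem one_sub_updatedPart_mul_sweepM (hn : sites.Nodup) (hc : ∀ x, x ∈ sites) :
    (1 - (ζ / siteFreqSq d m) • updatedPart sites) * sweepM m ζ sites =
      (1 - ζ) • (1 : Matrix (Site d L) (Site d L) ℝ) +
        (ζ / siteFreqSq d m) • (adjacency d L - updatedPart sites) := by
  refine Matrix.ext_of_mulVec_single fun y => ?_
  ext x
  have h := sweep_apply m ζ 0 sites hn (Pi.single y 1) x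
  rw [if_pos (hc x)] at h
  simp only [Matrix.mulVec_zero, add_zero, Pi.zero_apply, mul_zero] at h
  rw [← Matrix.mulVec_mulVec, Matrix.sub_mulVec, Matrix.one_mulVec, Pi.sub_apply, h]
  simp only [Matrix.smul_mulVec, Matrix.add_mulVec, Pi.add_apply, Pi.smul_apply, smul_eq_mul,
    Matrix.one_mulVec]
  rw [add_sub_assoc, ← mul_sub]
  congr 2
  simp only [Matrix.mulVec, dotProduct, updatedPart, Matrix.of_apply, Matrix.sub_apply]
  rw [← Finset.sum_sub_distrib]
  refine Finset.sum_congr rfl fun z _ => ?_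
  split_ifs <;> ring

/-- Of two distinct sites exactly one is updated first. The diagonal of the adjacency matrix
vanishes because L ≥ 2; for L = 1 and d ≥ 1 a site is its own neighbour. -/
theorem updatedPart_add_transpose (hL : 2 ≤ L) (hc : ∀ x, x ∈ sites) :
    updatedPart sites + (updatedPart sites)ᵀ = adjacency d L := by
  ext x y
  simp only [updatedPart, Matrix.add_apply, Matrix.transpose_apply, Matrix.of_apply]
  rcases eq_or_ne x y with rfl | hxy
  · simp [adjacency_self hL]
  · have : sites.idxOf x ≠ sites.idxOf y := fun h => hxy ((List.idxOf_inj (hc x)).1 h)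
    rcases lt_or_gt_of_ne this with h | h
    · simp [h, h.le.not_gt, adjacency_comm]
    · simp [h, h.le.not_gt]

end SweepEquations

/-! ### Plane waves, the unitary Fourier matrix, and translation-invariant operators. -/

section FourierMatrices

variable {d L : ℕ} [NeZero L]

/-- The plane wave `e^{2πi p·x/L}`. -/
noncomputable def wave (p x : Site d L) : ℂ := ZMod.stdAddChar (∑ μ : Fin d, p μ * x μ)

theorem wave_add_right (p x y : Site d L) : wave p (x + y) = wave p x * wave p y := by
  simp [wave, mul_add, Finset.sum_add_distrib, AddChar.map_add_eq_mul]

theorem wave_comm (p x : Site d L) : wave p x = wave x p := by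
  simp [wave, mul_comm]

theorem wave_add_left (p q x : Site d L) : wave (p + q) x = wave p x * wave q x := by
  rw [wave_comm, wave_add_right, wave_comm x p, wave_comm x q]

theorem wave_zero_left (x : Site d L) : wave 0 x = 1 := by simp [wave]

theorem wave_neg_right (p x : Site d L) : wave p (-x) = conj (wave p x) := by
  simp [wave, AddChar.map_neg_eq_conj]

theorem wave_neg_left (p x : Site d L) : wave (-p) x = conj (wave p x) := by
  rw [wave_comm, wave_neg_right, wave_comm]

theorem wave_unitVec (p : Site d L) (μ : Fin d) :
    wave p (unitVec d L μ) = ZMod.stdAddChar (p μ) := by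
  simp [wave, unitVec, Pi.single_apply]

theorem norm_wave (p x : Site d L) : ‖wave p x‖ = 1 := by simp [wave]

theorem sum_wave (p : Site d L) : ∑ x, wave p x = if p = 0 then (L : ℂ) ^ d else 0 := by
  split_ifs with hp
  · subst hp
    simp [wave_zero_left, ZMod.card]
  · obtain ⟨μ, hμ⟩ : ∃ μ, p μ ≠ 0 := by
      by_contra! h
      exact hp (funext h)
    have h1 : wave p (unitVec d L μ) ≠ 1 := by
      rw [wave_unitVec]
      intro h
      exact hμ (ZMod.injective_stdAddChar (by rw [h, AddChar.map_zero_eq_one]))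
    have h2 : wave p (unitVec d L μ) * ∑ x, wave p x = ∑ x, wave p x := by
      rw [Finset.mul_sum]
      refine Fintype.sum_equiv (Equiv.addLeft (unitVec d L μ)) _ _ fun x => ?_
      simp [wave_add_right]
    by_contra hne
    exact h1 ((mul_eq_right₀ hne).1 h2)

theorem dft_apply (p x : Site d L) :
    dft d L p x = ((Real.sqrt ((L : ℝ) ^ d))⁻¹ : ℝ) * conj (wave p x) := by
  rw [← wave_neg_right]
  simp [dft, wave]

theorem sqrt_volume_inv_mul_self :
    (((Real.sqrt ((L : ℝ) ^ d))⁻¹ : ℝ) : ℂ) * ((Real.sqrt ((L : ℝ) ^ d))⁻¹ : ℝ) =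
      ((L : ℂ) ^ d)⁻¹ := by
  rw [← Complex.ofReal_mul, ← mul_inv, Real.mul_self_sqrt (by positivity)]
  simp

theorem volume_ne_zero : ((L : ℂ) ^ d) ≠ 0 := pow_ne_zero _ (NeZero.ne _)

theorem dft_mul_conjTranspose : dft d L * (dft d L)ᴴ = 1 := by
  ext p q
  have h : ∀ x, dft d L p x * (dft d L)ᴴ x q = ((L : ℂ) ^ d)⁻¹ * wave (q - p) x := fun x => by
    rw [Matrix.conjTranspose_apply, dft_apply, dft_apply, sub_eq_add_neg, wave_add_left,
      wave_neg_left, ← sqrt_volume_inv_mul_self]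
    simp
    ring
  rw [Matrix.mul_apply, Finset.sum_congr rfl fun x _ => h x, ← Finset.mul_sum, sum_wave,
    Matrix.one_apply]
  simp only [sub_eq_zero, eq_comm (a := q)]
  split_ifs
  · exact inv_mul_cancel₀ volume_ne_zero
  · simp

theorem conjTranspose_mul_dft : (dft d L)ᴴ * dft d L = 1 :=
  mul_eq_one_comm.1 dft_mul_conjTranspose

theorem momentumRep_one : momentumRep (1 : Matrix (Site d L) (Site d L) ℝ) = 1 := by
  have : (1 : Matrix (Site d L) (Site d L) ℝ).map (fun r : ℝ => (r : ℂ)) = 1 :=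
    Matrix.map_one _ Complex.ofReal_zero Complex.ofReal_one
  rw [momentumRep, this, mul_one, dft_mul_conjTranspose]

theorem momentumRep_mul (A B : Matrix (Site d L) (Site d L) ℝ) :
    momentumRep (A * B) = momentumRep A * momentumRep B := by
  have : (A * B).map (fun r : ℝ => (r : ℂ)) =
      A.map (fun r : ℝ => (r : ℂ)) * B.map (fun r : ℝ => (r : ℂ)) :=
    Matrix.map_mul (f := Complex.ofRealHom)
  rw [momentumRep, this, momentumRep, momentumRep]
  calc _ = dft d L * A.map (fun r : ℝ => (r : ℂ)) * 1 *
          B.map (fun r : ℝ => (r : ℂ)) * (dft d L)ᴴ := by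
        simp only [mul_one, Matrix.mul_assoc]
    _ = _ := by rw [← conjTranspose_mul_dft]; simp only [Matrix.mul_assoc]

theorem momentumRep_add (A B : Matrix (Site d L) (Site d L) ℝ) :
    momentumRep (A + B) = momentumRep A + momentumRep B := by
  rw [momentumRep, Matrix.map_add _ Complex.ofReal_add, Matrix.mul_add, Matrix.add_mul]; rfl

theorem momentumRep_sub (A B : Matrix (Site d L) (Site d L) ℝ) :
    momentumRep (A - B) = momentumRep A - momentumRep B := by
  rw [momentumRep, Matrix.map_sub _ Complex.ofReal_sub, Matrix.mul_sub, Matrix.sub_mul]; rfl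

theorem momentumRep_smul (c : ℝ) (A : Matrix (Site d L) (Site d L) ℝ) :
    momentumRep (c • A) = (c : ℂ) • momentumRep A := by
  have : (c • A).map (fun r : ℝ => (r : ℂ)) = (c : ℂ) • A.map (fun r : ℝ => (r : ℂ)) := by
    ext; simp
  rw [momentumRep, this, Matrix.mul_smul, Matrix.smul_mul]; rfl

theorem momentumRep_zero : momentumRep (0 : Matrix (Site d L) (Site d L) ℝ) = 0 := by
  simpa using momentumRep_smul 0 (0 : Matrix (Site d L) (Site d L) ℝ)

theorem momentumRep_sum {ι : Type*} (s : Finset ι) (A : ι → Matrix (Site d L) (Site d L) ℝ) :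
    momentumRep (∑ i ∈ s, A i) = ∑ i ∈ s, momentumRep (A i) := by
  classical
  induction s using Finset.induction_on with
  | empty => simp [momentumRep_zero]
  | insert i s hi ih => rw [Finset.sum_insert hi, Finset.sum_insert hi, momentumRep_add, ih]

theorem momentumRep_transpose (A : Matrix (Site d L) (Site d L) ℝ) :
    momentumRep Aᵀ = (momentumRep A)ᴴ := by
  have : Aᵀ.map (fun r : ℝ => (r : ℂ)) = (A.map (fun r : ℝ => (r : ℂ)))ᴴ := by
    ext; simp [Matrix.conjTranspose_apply]
  rw [momentumRep, this, momentumRep]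
  simp only [Matrix.conjTranspose_mul, Matrix.conjTranspose_conjTranspose, Matrix.mul_assoc]

/-- The matrix of the lattice translation by `v`. -/
def shift (v : Site d L) : Matrix (Site d L) (Site d L) ℝ :=
  Matrix.of fun x y => if x + v = y then 1 else 0

theorem momentumRep_shift (v : Site d L) :
    momentumRep (shift v) = Matrix.diagonal fun p => wave p v := by
  have h : dft d L * (shift v).map (fun r : ℝ => (r : ℂ)) =
      (Matrix.diagonal fun p => wave p v) * dft d L := by
    ext p y
    rw [Matrix.mul_apply, Matrix.diagonal_mul, Finset.sum_eq_single (y - v)]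
    · rw [dft_apply, dft_apply, sub_eq_add_neg, wave_add_right, wave_neg_right]
      simp [shift]
      ring
    · intro x _ hx
      simp [shift, ← eq_sub_iff_add_eq, hx]
    · simp
  rw [momentumRep, h, Matrix.mul_assoc, dft_mul_conjTranspose, mul_one]

/-- The lattice dispersion sum `∑_μ e^{2πi p_μ/L}`. -/
noncomputable def phaseSum (p : Site d L) : ℂ := ∑ μ : Fin d, ZMod.stdAddChar (p μ)

theorem conj_phaseSum (p : Site d L) :
    conj (phaseSum p) = ∑ μ : Fin d, ZMod.stdAddChar (-(p μ)) := by
  simp [phaseSum, AddChar.map_neg_eq_conj]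

theorem norm_phaseSum_le (p : Site d L) : ‖phaseSum p‖ ≤ d := by
  refine (norm_sum_le _ _).trans ?_
  simp

/-- The part of the adjacency matrix that connects a site to its backward neighbours. -/
noncomputable def backwardPart (d L : ℕ) [NeZero L] : Matrix (Site d L) (Site d L) ℝ :=
  ∑ μ : Fin d, shift (-unitVec d L μ)

theorem adjacency_eq : adjacency d L = (∑ μ : Fin d, shift (unitVec d L μ)) + backwardPart d L := by
  ext x y
  simp [adjacency, backwardPart, shift, Matrix.add_apply, Matrix.sum_apply,
    Finset.sum_add_distrib, ← sub_eq_add_neg]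

theorem sum_diagonal {ι n : Type*} [DecidableEq n] (s : Finset ι) (f : ι → n → ℂ) :
    ∑ i ∈ s, Matrix.diagonal (f i) = Matrix.diagonal fun p => ∑ i ∈ s, f i p := by
  ext p q
  simp only [Matrix.sum_apply, Matrix.diagonal_apply]
  split_ifs <;> simp

theorem momentumRep_backwardPart :
    momentumRep (backwardPart d L) = Matrix.diagonal fun p => conj (phaseSum p) := by
  simp only [backwardPart, momentumRep_sum, momentumRep_shift, sum_diagonal, wave_neg_right,
    wave_unitVec, phaseSum, map_sum]

/-- The eigenvalues of the inverse covariance matrix. -/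
noncomputable def invCovEig (m : ℝ) (p : Site d L) : ℝ := siteFreqSq d m - 2 * (phaseSum p).re

theorem momentumRep_invCov (m : ℝ) :
    momentumRep (invCov d L m) = Matrix.diagonal fun p => (invCovEig m p : ℂ) := by
  rw [invCov, momentumRep_sub, momentumRep_smul, momentumRep_one, adjacency_eq, momentumRep_add,
    momentumRep_backwardPart, momentumRep_sum]
  simp only [momentumRep_shift, sum_diagonal, wave_unitVec]
  change _ - (Matrix.diagonal (fun p => phaseSum p) + _) = _
  ext p q
  simp only [Matrix.sub_apply, Matrix.smul_apply, Matrix.one_apply, Matrix.add_apply,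
    Matrix.diagonal_apply, smul_eq_mul]
  split_ifs
  · rw [Complex.add_conj]
    simp [invCovEig]
  · simp

theorem sq_le_invCovEig (m : ℝ) (p : Site d L) : m ^ 2 ≤ invCovEig m p := by
  have := (Complex.re_le_norm _).trans (norm_phaseSum_le p)
  simp only [invCovEig, siteFreqSq]
  linarith

theorem invCovEig_le (m : ℝ) (p : Site d L) : invCovEig m p ≤ m ^ 2 + 4 * d := by
  have := (abs_le.1 (Complex.abs_re_le_norm (phaseSum p))).1
  have := norm_phaseSum_le p
  simp only [invCovEig, siteFreqSq]
  linarith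

end FourierMatrices

/-! ### The resolvent, invariance of the covariance, and its consequences. -/

section Resolvent

variable {d L : ℕ} [NeZero L]

theorem siteFreqSq_pos (d : ℕ) {m : ℝ} (hm : 0 < m) : 0 < siteFreqSq d m := by
  unfold siteFreqSq; positivity

theorem noiseAmp_pos (d : ℕ) {m ζ : ℝ} (hm : 0 < m) (hζ0 : 0 < ζ) (hζ2 : ζ < 2) :
    0 < noiseAmp d m ζ :=
  div_pos (Real.sqrt_pos.2 (mul_pos hζ0 (by linarith))) (Real.sqrt_pos.2 (siteFreqSq_pos d hm))

theorem noiseAmp_sq (d : ℕ) {m ζ : ℝ} (hm : 0 < m) (hζ0 : 0 < ζ) (hζ2 : ζ < 2) :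
    noiseAmp d m ζ ^ 2 = ζ / siteFreqSq d m * (2 - ζ) := by
  rw [noiseAmp, div_pow, Real.sq_sqrt (mul_nonneg hζ0.le (by linarith)),
    Real.sq_sqrt (siteFreqSq_pos d hm).le]
  ring

/-- The resolvent `(1 - t N)⁻¹` of the updated part of the adjacency matrix, in momentum space. -/
noncomputable def resolvent (m ζ : ℝ) (sites : List (Site d L)) :
    Matrix (Site d L) (Site d L) ℂ :=
  ((noiseAmp d m ζ)⁻¹ : ℂ) • momP m ζ sites

/-- The covariance matrix of the free field, in momentum space. -/
noncomputable def momCov (d L : ℕ) [NeZero L] (m : ℝ) : Matrix (Site d L) (Site d L) ℂ :=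
  Matrix.diagonal fun p => ((invCovEig m p : ℂ))⁻¹

variable {m ζ : ℝ} {sites : List (Site d L)}

/-- No triangularity argument is needed for invertibility: the noise matrix is itself the inverse up
to its amplitude, and for square matrices a right inverse is two-sided. -/
theorem one_sub_updatedPart_mul_resolvent (hm : 0 < m) (hζ0 : 0 < ζ) (hζ2 : ζ < 2)
    (hn : sites.Nodup) (hc : ∀ x, x ∈ sites) :
    (1 - ((ζ / siteFreqSq d m : ℝ) : ℂ) • momentumRep (updatedPart sites)) *
      resolvent m ζ sites = 1 := by
  have h := congrArg momentumRep
    (one_sub_updatedPart_mul_sweepP (m := m) (ζ := ζ) hn hc)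
  rw [momentumRep_mul, momentumRep_sub, momentumRep_smul, momentumRep_smul, momentumRep_one] at h
  rw [resolvent, momP, Matrix.mul_smul, h, smul_smul, inv_mul_cancel₀, one_smul]
  exact_mod_cast (noiseAmp_pos d hm hζ0 hζ2).ne'

/-- K = W + W† - (2 - ζ), from N + Nᵀ being the adjacency matrix and tω² = ζ. -/
theorem smul_momentumRep_invCov (hm : 0 < m) (hL : 2 ≤ L) (hc : ∀ x, x ∈ sites) :
    ((ζ / siteFreqSq d m : ℝ) : ℂ) • momentumRep (invCov d L m) =
      (1 - ((ζ / siteFreqSq d m : ℝ) : ℂ) • momentumRep (updatedPart sites)) +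
      (1 - ((ζ / siteFreqSq d m : ℝ) : ℂ) • momentumRep (updatedPart sites))ᴴ -
        (2 - ζ : ℂ) • (1 : Matrix (Site d L) (Site d L) ℂ) := by
  have h : ((ζ / siteFreqSq d m : ℝ) : ℂ) * (siteFreqSq d m : ℂ) = ζ := by
    rw [← Complex.ofReal_mul, div_mul_cancel₀ _ (siteFreqSq_pos d hm).ne']
  rw [invCov, ← updatedPart_add_transpose hL hc, momentumRep_sub, momentumRep_add,
    momentumRep_transpose, momentumRep_smul, momentumRep_one]
  simp only [Matrix.conjTranspose_sub, Matrix.conjTranspose_smul, Matrix.conjTranspose_one,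
    smul_sub, smul_add, smul_smul, h, sub_smul, Complex.star_def, Complex.conj_ofReal]
  rw [show (2 : ℂ) = 1 + 1 by norm_num, add_smul, one_smul]
  abel

/-- Multiplied by W this reads WM = W - K, and both sides equal 1 - ζ + tN†. -/
theorem momM_eq (hm : 0 < m) (hζ0 : 0 < ζ) (hζ2 : ζ < 2) (hL : 2 ≤ L)
    (hn : sites.Nodup) (hc : ∀ x, x ∈ sites) :
    momM m ζ sites = 1 - resolvent m ζ sites *
      (((ζ / siteFreqSq d m : ℝ) : ℂ) • momentumRep (invCov d L m)) := by
  have hW := one_sub_updatedPart_mul_resolvent hm hζ0 hζ2 hn hc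
  have hW' := mul_eq_one_comm.1 hW
  have h := congrArg momentumRep
    (one_sub_updatedPart_mul_sweepM (m := m) (ζ := ζ) hn hc)
  rw [← updatedPart_add_transpose hL hc, add_sub_cancel_left, momentumRep_mul, momentumRep_sub,
    momentumRep_smul, momentumRep_one, momentumRep_add, momentumRep_smul, momentumRep_smul,
    momentumRep_one, momentumRep_transpose] at h
  have hM : momM m ζ sites = resolvent m ζ sites *
      ((1 - ((ζ / siteFreqSq d m : ℝ) : ℂ) • momentumRep (updatedPart sites)) *
        momM m ζ sites) := by
    rw [← Matrix.mul_assoc, hW', one_mul]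
  have hsub : ∀ A, 1 - resolvent m ζ sites * A = resolvent m ζ sites *
      ((1 - ((ζ / siteFreqSq d m : ℝ) : ℂ) • momentumRep (updatedPart sites)) - A) := fun A => by
    rw [Matrix.mul_sub, hW']
  rw [hM, momM, h, smul_momentumRep_invCov hm hL hc, hsub]
  congr 1
  simp only [Matrix.conjTranspose_sub, Matrix.conjTranspose_smul, Matrix.conjTranspose_one,
    sub_smul, Complex.star_def, Complex.conj_ofReal, Complex.ofReal_sub, Complex.ofReal_one]
  rw [show (2 : ℂ) = 1 + 1 by norm_num, add_smul, one_smul]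
  abel

theorem invCovEig_pos (hm : 0 < m) (p : Site d L) : 0 < invCovEig m p :=
  (pow_pos hm 2).trans_le (sq_le_invCovEig m p)

theorem momentumRep_invCov_mul_momCov (hm : 0 < m) :
    momentumRep (invCov d L m) * momCov d L m = 1 := by
  rw [momentumRep_invCov, momCov, Matrix.diagonal_mul_diagonal, ← Matrix.diagonal_one]
  congr 1
  ext p
  exact mul_inv_cancel₀ (by exact_mod_cast (invCovEig_pos hm p).ne')

/-- The sweep leaves the covariance of the free field invariant. -/
theorem fluctuation_dissipation (hm : 0 < m) (hζ0 : 0 < ζ) (hζ2 : ζ < 2) (hL : 2 ≤ L)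
    (hn : sites.Nodup) (hc : ∀ x, x ∈ sites) :
    ((noiseAmp d m ζ ^ 2 : ℝ) : ℂ) • (resolvent m ζ sites * (resolvent m ζ sites)ᴴ) +
      momM m ζ sites * momCov d L m * (momM m ζ sites)ᴴ = momCov d L m := by
  have hW := one_sub_updatedPart_mul_resolvent hm hζ0 hζ2 hn hc
  have hW' := mul_eq_one_comm.1 hW
  have hM := momM_eq hm hζ0 hζ2 hL hn hc
  have hK := smul_momentumRep_invCov (ζ := ζ) hm hL hc
  have hKD : (((ζ / siteFreqSq d m : ℝ) : ℂ) • momentumRep (invCov d L m)) * momCov d L m =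
      ((ζ / siteFreqSq d m : ℝ) : ℂ) • 1 := by
    rw [Matrix.smul_mul, momentumRep_invCov_mul_momCov hm]
  have hDK : momCov d L m * (((ζ / siteFreqSq d m : ℝ) : ℂ) • momentumRep (invCov d L m)) =
      ((ζ / siteFreqSq d m : ℝ) : ℂ) • 1 := by
    rw [Matrix.mul_smul, mul_eq_one_comm.1 (momentumRep_invCov_mul_momCov hm)]
  have hKh : (((ζ / siteFreqSq d m : ℝ) : ℂ) • momentumRep (invCov d L m))ᴴ =
      ((ζ / siteFreqSq d m : ℝ) : ℂ) • momentumRep (invCov d L m) := by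
    rw [momentumRep_invCov, Matrix.conjTranspose_smul, Matrix.diagonal_conjTranspose]
    congr 1
    · simp
    · congr 1; ext; simp
  rw [hM, Matrix.conjTranspose_sub, Matrix.conjTranspose_mul, hKh, Matrix.conjTranspose_one,
    noiseAmp_sq d hm hζ0 hζ2, Complex.ofReal_mul, Complex.ofReal_sub, Complex.ofReal_ofNat]
  set t : ℂ := ((ζ / siteFreqSq d m : ℝ) : ℂ)
  set K := t • momentumRep (invCov d L m)
  set G := resolvent m ζ sites
  set W := 1 - t • momentumRep (updatedPart sites)
  have hGW : Wᴴ * Gᴴ = 1 := by rw [← Matrix.conjTranspose_mul, hW', Matrix.conjTranspose_one]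
  have h1 : (1 - G * K) * momCov d L m * (1 - K * Gᴴ) =
      momCov d L m - G * (K * momCov d L m) - (momCov d L m * K) * Gᴴ +
        G * (K * momCov d L m) * K * Gᴴ := by noncomm_ring
  -- Inserting K = W + W† - (2 - ζ) cancels the linear terms of the expansion; the remaining -t(2 -
  -- ζ)GG† is compensated by σ² = t(2 - ζ).
  have h2 : G * K * Gᴴ = Gᴴ + G - (2 - ζ : ℂ) • (G * Gᴴ) := by
    rw [hK, Matrix.mul_sub, Matrix.mul_add, Matrix.sub_mul, Matrix.add_mul, hW', one_mul,
      Matrix.mul_assoc G, hGW, mul_one, Matrix.mul_smul, mul_one, Matrix.smul_mul]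
  rw [h1, hKD, hDK]
  simp only [Matrix.mul_smul, Matrix.smul_mul, mul_one, one_mul, h2, smul_sub, smul_add, smul_smul]
  abel

theorem mul_conjTranspose_apply_self (A : Matrix (Site d L) (Site d L) ℂ) (p : Site d L) :
    (A * Aᴴ) p p = ((∑ q, ‖A p q‖ ^ 2 : ℝ) : ℂ) := by
  rw [Matrix.mul_apply]
  push_cast
  refine Finset.sum_congr rfl fun q _ => ?_
  rw [Matrix.conjTranspose_apply, Complex.star_def, Complex.mul_conj, Complex.normSq_eq_norm_sq]
  simp

theorem mul_momCov_mul_conjTranspose_apply_self (A : Matrix (Site d L) (Site d L) ℂ)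
    (p : Site d L) :
    (A * momCov d L m * Aᴴ) p p = ((∑ q, ‖A p q‖ ^ 2 / invCovEig m q : ℝ) : ℂ) := by
  rw [Matrix.mul_apply]
  push_cast
  refine Finset.sum_congr rfl fun q _ => ?_
  rw [Matrix.conjTranspose_apply, Complex.star_def, momCov, Matrix.mul_diagonal, mul_right_comm,
    Complex.mul_conj, Complex.normSq_eq_norm_sq]
  simp [div_eq_mul_inv]

/-- A diagonal entry of X(·)X† applied to the invariance of the covariance, written as sums of
squares. X = 1 gives strict decrease of the covariance vector; general X gives the ℓ² bound on the
resolvent. -/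
theorem row_identity (hm : 0 < m) (hζ0 : 0 < ζ) (hζ2 : ζ < 2) (hL : 2 ≤ L)
    (hn : sites.Nodup) (hc : ∀ x, x ∈ sites) (X : Matrix (Site d L) (Site d L) ℂ)
    (p : Site d L) :
    noiseAmp d m ζ ^ 2 * ∑ q, ‖(X * resolvent m ζ sites) p q‖ ^ 2 +
      ∑ q, ‖(X * momM m ζ sites) p q‖ ^ 2 / invCovEig m q = ∑ q, ‖X p q‖ ^ 2 / invCovEig m q := by
  have h := congrArg (fun A => (X * A * Xᴴ) p p) (fluctuation_dissipation hm hζ0 hζ2 hL hn hc)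
  have e : X * (((noiseAmp d m ζ ^ 2 : ℝ) : ℂ) •
        (resolvent m ζ sites * (resolvent m ζ sites)ᴴ) +
      momM m ζ sites * momCov d L m * (momM m ζ sites)ᴴ) * Xᴴ =
      ((noiseAmp d m ζ ^ 2 : ℝ) : ℂ) •
        ((X * resolvent m ζ sites) * (X * resolvent m ζ sites)ᴴ) +
      (X * momM m ζ sites) * momCov d L m * (X * momM m ζ sites)ᴴ := by
    simp only [Matrix.conjTranspose_mul, Matrix.mul_add, Matrix.add_mul, Matrix.mul_smul,
      Matrix.smul_mul, Matrix.mul_assoc]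
  simp only [e] at h
  rw [Matrix.add_apply, Matrix.smul_apply, mul_conjTranspose_apply_self,
    mul_momCov_mul_conjTranspose_apply_self, mul_momCov_mul_conjTranspose_apply_self,
    smul_eq_mul] at h
  exact_mod_cast h

/-- The resolvent is bounded in the Euclidean norm, uniformly in the volume. -/
theorem row_mul_resolvent_le (hm : 0 < m) (hζ0 : 0 < ζ) (hζ2 : ζ < 2) (hL : 2 ≤ L)
    (hn : sites.Nodup) (hc : ∀ x, x ∈ sites) (X : Matrix (Site d L) (Site d L) ℂ)
    (p : Site d L) :
    ∑ q, ‖(X * resolvent m ζ sites) p q‖ ^ 2 ≤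
      (noiseAmp d m ζ ^ 2 * m ^ 2)⁻¹ * ∑ q, ‖X p q‖ ^ 2 := by
  have h := row_identity hm hζ0 hζ2 hL hn hc X p
  have h1 : 0 ≤ ∑ q, ‖(X * momM m ζ sites) p q‖ ^ 2 / invCovEig m q :=
    Finset.sum_nonneg fun q _ => div_nonneg (by positivity) (invCovEig_pos hm q).le
  have h2 : ∑ q, ‖X p q‖ ^ 2 / invCovEig m q ≤ (∑ q, ‖X p q‖ ^ 2) / m ^ 2 := by
    rw [Finset.sum_div]
    exact Finset.sum_le_sum fun q _ =>
      div_le_div_of_nonneg_left (by positivity) (by positivity) (sq_le_invCovEig m q)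
  have h3 : 0 < noiseAmp d m ζ ^ 2 := pow_pos (noiseAmp_pos d hm hζ0 hζ2) 2
  rw [mul_inv, mul_assoc, ← div_eq_inv_mul, ← div_eq_inv_mul, le_div_iff₀ h3]
  linarith

theorem resolvent_row_pos (hm : 0 < m) (hζ0 : 0 < ζ) (hζ2 : ζ < 2)
    (hn : sites.Nodup) (hc : ∀ x, x ∈ sites) (p : Site d L) :
    0 < ∑ q, ‖resolvent m ζ sites p q‖ ^ 2 := by
  refine (Finset.sum_nonneg fun q _ => by positivity).lt_of_ne' fun h0 => ?_
  have h := mul_eq_one_comm.1 (one_sub_updatedPart_mul_resolvent hm hζ0 hζ2 hn hc)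
  have h1 := congrFun (congrFun h p) p
  rw [Finset.sum_eq_zero_iff_of_nonneg fun q _ => by positivity] at h0
  rw [Matrix.mul_apply, Finset.sum_eq_zero] at h1
  · simp at h1
  · intro q hq
    have := h0 q hq
    rw [pow_eq_zero_iff two_ne_zero, norm_eq_zero] at this
    rw [this, zero_mul]

/-- The quadratic update matrix strictly decreases the covariance. -/
theorem sum_normSq_momM_lt (hm : 0 < m) (hζ0 : 0 < ζ) (hζ2 : ζ < 2) (hL : 2 ≤ L)
    (hn : sites.Nodup) (hc : ∀ x, x ∈ sites) (p : Site d L) :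
    ∑ q, ‖momM m ζ sites p q‖ ^ 2 * (invCovEig m q)⁻¹ < (invCovEig m p)⁻¹ := by
  have h := row_identity hm hζ0 hζ2 hL hn hc 1 p
  have h1 : ∑ q, ‖(1 : Matrix (Site d L) (Site d L) ℂ) p q‖ ^ 2 / invCovEig m q =
      (invCovEig m p)⁻¹ := by
    rw [Finset.sum_eq_single p]
    · simp
    · intro q _ hq
      simp [Matrix.one_apply_ne' hq]
    · simp
  rw [h1] at h
  simp only [one_mul] at h
  have h3 : 0 < noiseAmp d m ζ ^ 2 := pow_pos (noiseAmp_pos d hm hζ0 hζ2) 2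
  have := mul_pos h3 (resolvent_row_pos hm hζ0 hζ2 hn hc p)
  simp only [div_eq_mul_inv] at h
  linarith

end Resolvent

/-! ### The diagonal matrix M^D and the explicit inverse at zero momentum. -/

section TranslationInvariantPart

variable {d L : ℕ} [NeZero L] {m ζ : ℝ}

/-- ζd ≤ 2d < m² + 2d. This keeps the denominators of M^D away from zero uniformly in L. -/
theorem mul_dim_lt_one (d : ℕ) (hm : 0 < m) (hζ2 : ζ < 2) :
    ζ / siteFreqSq d m * d < 1 := by
  rw [div_mul_eq_mul_div, div_lt_one (siteFreqSq_pos d hm), siteFreqSq]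
  have : ζ * d ≤ 2 * d := mul_le_mul_of_nonneg_right hζ2.le (Nat.cast_nonneg d)
  nlinarith [pow_pos hm 2]

theorem div_siteFreqSq_pos (d : ℕ) (hm : 0 < m) (hζ0 : 0 < ζ) : 0 < ζ / siteFreqSq d m :=
  div_pos hζ0 (siteFreqSq_pos d hm)

/-- The denominator of `M^D` in momentum space. -/
noncomputable def denom (m ζ : ℝ) (p : Site d L) : ℂ :=
  1 - ((ζ / siteFreqSq d m : ℝ) : ℂ) * conj (phaseSum p)

theorem le_norm_denom (hm : 0 < m) (hζ0 : 0 < ζ) (p : Site d L) :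
    1 - ζ / siteFreqSq d m * d ≤ ‖denom m ζ p‖ := by
  have h1 : ‖((ζ / siteFreqSq d m : ℝ) : ℂ) * conj (phaseSum p)‖ ≤ ζ / siteFreqSq d m * d := by
    rw [norm_mul, Complex.norm_real, Real.norm_of_nonneg (div_siteFreqSq_pos d hm hζ0).le,
      Complex.norm_conj]
    exact mul_le_mul_of_nonneg_left (norm_phaseSum_le p) (div_siteFreqSq_pos d hm hζ0).le
  have h2 := norm_sub_norm_le (1 : ℂ) (((ζ / siteFreqSq d m : ℝ) : ℂ) * conj (phaseSum p))
  rw [norm_one] at h2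
  rw [denom]
  linarith

theorem norm_denom_le (hm : 0 < m) (hζ0 : 0 < ζ) (hζ2 : ζ < 2) (p : Site d L) :
    ‖denom m ζ p‖ ≤ 2 := by
  have h1 : ‖((ζ / siteFreqSq d m : ℝ) : ℂ) * conj (phaseSum p)‖ ≤ ζ / siteFreqSq d m * d := by
    rw [norm_mul, Complex.norm_real, Real.norm_of_nonneg (div_siteFreqSq_pos d hm hζ0).le,
      Complex.norm_conj]
    exact mul_le_mul_of_nonneg_left (norm_phaseSum_le p) (div_siteFreqSq_pos d hm hζ0).le
  have h2 := norm_sub_le (1 : ℂ) (((ζ / siteFreqSq d m : ℝ) : ℂ) * conj (phaseSum p))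
  rw [norm_one] at h2
  have := mul_dim_lt_one d hm hζ2
  rw [denom]
  linarith

theorem denom_ne_zero (hm : 0 < m) (hζ0 : 0 < ζ) (hζ2 : ζ < 2) (p : Site d L) :
    denom m ζ p ≠ 0 := by
  have h1 := le_norm_denom hm hζ0 p
  have h2 := mul_dim_lt_one d hm hζ2
  exact norm_pos_iff.1 (by linarith)

/-- The same form as `momM_eq` with the resolvent replaced by 1/`denom`, so the two update matrices
differ exactly by the difference of the resolvents. -/
theorem momMD_eq (hm : 0 < m) (hζ0 : 0 < ζ) (hζ2 : ζ < 2) :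
    momMD d L m ζ = 1 - Matrix.diagonal (fun p => (denom m ζ p)⁻¹) *
      (((ζ / siteFreqSq d m : ℝ) : ℂ) • momentumRep (invCov d L m)) := by
  rw [momentumRep_invCov, ← Matrix.diagonal_smul, Matrix.diagonal_mul_diagonal,
    ← Matrix.diagonal_one, Matrix.diagonal_sub, momMD]
  congr 1
  ext p
  rw [← conj_phaseSum]
  have hd := denom_ne_zero hm hζ0 hζ2 p
  change (1 - (ζ : ℂ) + ((ζ / siteFreqSq d m : ℝ) : ℂ) * phaseSum p) / denom m ζ p = _
  rw [div_eq_iff hd, sub_mul, mul_comm _⁻¹, mul_assoc, inv_mul_cancel₀ hd]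
  have h : ((ζ / siteFreqSq d m : ℝ) : ℂ) * (siteFreqSq d m : ℂ) = ζ := by
    rw [← Complex.ofReal_mul, div_mul_cancel₀ _ (siteFreqSq_pos d hm).ne']
  have h2 : ((2 * (phaseSum p).re : ℝ) : ℂ) = phaseSum p + conj (phaseSum p) :=
    (Complex.add_conj _).symm
  simp only [Pi.smul_apply, smul_eq_mul, invCovEig]
  rw [Complex.ofReal_sub, h2, mul_sub, h, denom]
  ring

/-- The scalar counterpart of `fluctuation_dissipation`; the only relation used in the algebra is
tω² = ζ. -/
theorem one_sub_normSq_momMD (hm : 0 < m) (hζ0 : 0 < ζ) (hζ2 : ζ < 2) (p : Site d L) :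
    1 - ‖momMD d L m ζ p p‖ ^ 2 =
      (2 - ζ) * (ζ / siteFreqSq d m) * invCovEig m p / ‖denom m ζ p‖ ^ 2 := by
  have hd : ‖denom m ζ p‖ ^ 2 ≠ 0 := pow_ne_zero 2 (norm_ne_zero_iff.2 (denom_ne_zero hm hζ0 hζ2 p))
  have h1 : momMD d L m ζ p p =
      (1 - (ζ : ℂ) + ((ζ / siteFreqSq d m : ℝ) : ℂ) * phaseSum p) / denom m ζ p := by
    rw [momMD, Matrix.diagonal_apply_eq, ← conj_phaseSum]
    rfl
  rw [h1, norm_div, div_pow, eq_div_iff hd, sub_mul, div_mul_cancel₀ _ hd,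
    ← Complex.normSq_eq_norm_sq, ← Complex.normSq_eq_norm_sq, denom, invCovEig]
  have h : ζ / siteFreqSq d m * siteFreqSq d m = ζ := div_mul_cancel₀ _ (siteFreqSq_pos d hm).ne'
  set t := ζ / siteFreqSq d m
  simp only [Complex.normSq_apply, Complex.sub_re, Complex.sub_im, Complex.add_re, Complex.add_im,
    Complex.mul_re, Complex.mul_im, Complex.conj_re, Complex.conj_im, Complex.ofReal_re,
    Complex.ofReal_im, Complex.one_re, Complex.one_im]
  linear_combination (-(2 - ζ)) * h

theorem absSq_apply (A : Matrix (Site d L) (Site d L) ℂ) (p q : Site d L) :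
    absSq A p q = ((‖A p q‖ ^ 2 : ℝ) : ℂ) := by
  rw [absSq, Matrix.hadamard_apply, Matrix.map_apply, ← Complex.normSq_eq_norm_sq,
    Complex.normSq_eq_conj_mul_self]

theorem momMD_apply_ne {p q : Site d L} (h : p ≠ q) : momMD d L m ζ p q = 0 := by
  rw [momMD, Matrix.diagonal_apply_ne _ h]

theorem one_sub_absSq_momMD (hm : 0 < m) (hζ0 : 0 < ζ) (hζ2 : ζ < 2) :
    1 - absSq (momMD d L m ζ) = Matrix.diagonal fun p =>
      (((2 - ζ) * (ζ / siteFreqSq d m) * invCovEig m p / ‖denom m ζ p‖ ^ 2 : ℝ) : ℂ) := by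
  ext p q
  rw [Matrix.sub_apply, absSq_apply]
  rcases eq_or_ne p q with rfl | h
  · rw [Matrix.one_apply_eq, Matrix.diagonal_apply_eq, ← one_sub_normSq_momMD hm hζ0 hζ2]
    push_cast
    rfl
  · simp [h, momMD_apply_ne]

theorem gap_pos (hm : 0 < m) (hζ0 : 0 < ζ) (hζ2 : ζ < 2) (p : Site d L) :
    0 < (2 - ζ) * (ζ / siteFreqSq d m) * invCovEig m p / ‖denom m ζ p‖ ^ 2 :=
  div_pos (mul_pos (mul_pos (by linarith) (div_siteFreqSq_pos d hm hζ0)) (invCovEig_pos hm p))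
    (pow_pos (norm_pos_iff.2 (denom_ne_zero hm hζ0 hζ2 p)) 2)

theorem norm_momMD_le (hm : 0 < m) (hζ0 : 0 < ζ) (hζ2 : ζ < 2) (p : Site d L) :
    ‖momMD d L m ζ p p‖ ≤ 1 := by
  have h1 := one_sub_normSq_momMD hm hζ0 hζ2 p
  have h2 := gap_pos hm hζ0 hζ2 p
  rw [← h1] at h2
  nlinarith [norm_nonneg (momMD d L m ζ p p)]

theorem isUnit_one_sub_absSq_momMD (hm : 0 < m) (hζ0 : 0 < ζ) (hζ2 : ζ < 2) :
    IsUnit (1 - absSq (momMD d L m ζ)) := by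
  rw [one_sub_absSq_momMD hm hζ0 hζ2, Matrix.isUnit_diagonal, Pi.isUnit_iff]
  exact fun p => isUnit_iff_ne_zero.2 (by exact_mod_cast (gap_pos hm hζ0 hζ2 p).ne')

theorem inv_one_sub_absSq_momMD (hm : 0 < m) (hζ0 : 0 < ζ) (hζ2 : ζ < 2) :
    (1 - absSq (momMD d L m ζ))⁻¹ = Matrix.diagonal fun p =>
      (((2 - ζ) * (ζ / siteFreqSq d m) * invCovEig m p / ‖denom m ζ p‖ ^ 2 : ℝ) : ℂ)⁻¹ := by
  refine Matrix.inv_eq_right_inv ?_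
  rw [one_sub_absSq_momMD hm hζ0 hζ2, Matrix.diagonal_mul_diagonal, ← Matrix.diagonal_one]
  congr 1
  ext p
  exact mul_inv_cancel₀ (by exact_mod_cast (gap_pos hm hζ0 hζ2 p).ne')

/-- The 4 bounds the squared modulus of `denom` and m² is a lower bound for the spectrum of -Δ + m²;
neither depends on L. -/
theorem norm_inv_one_sub_absSq_momMD_le (hm : 0 < m) (hζ0 : 0 < ζ) (hζ2 : ζ < 2) :
    ‖(1 - absSq (momMD d L m ζ))⁻¹‖ ≤
      4 / ((2 - ζ) * (ζ / siteFreqSq d m) * m ^ 2) := by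
  have h0 : 0 < (2 - ζ) * (ζ / siteFreqSq d m) :=
    mul_pos (by linarith) (div_siteFreqSq_pos d hm hζ0)
  rw [inv_one_sub_absSq_momMD hm hζ0 hζ2, Matrix.linfty_opNorm_diagonal,
    pi_norm_le_iff_of_nonneg (by positivity)]
  intro p
  rw [norm_inv, Complex.norm_real, Real.norm_of_nonneg (gap_pos hm hζ0 hζ2 p).le, inv_div]
  have h1 := norm_denom_le hm hζ0 hζ2 p
  have h2 := sq_le_invCovEig m p
  have h3 : ‖denom m ζ p‖ ^ 2 ≤ 4 := by nlinarith [norm_nonneg (denom m ζ p)]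
  gcongr

theorem inv_one_sub_absSq_momMD_zero (hm : 0 < m) (hζ0 : 0 < ζ) (hζ2 : ζ < 2) :
    (1 - absSq (momMD d L m ζ))⁻¹ 0 0 = (infiniteVolumeValue d m ζ : ℂ) := by
  rw [inv_one_sub_absSq_momMD hm hζ0 hζ2, Matrix.diagonal_apply_eq, ← Complex.ofReal_inv]
  congr 1
  have hs : phaseSum (0 : Site d L) = d := by simp [phaseSum]
  have hω : m ^ 2 + 2 * (d : ℝ) ≠ 0 := (siteFreqSq_pos d hm).ne'
  have h2 : (2 - ζ) ≠ 0 := by linarith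
  have hd : ‖denom m ζ (0 : Site d L)‖ = |1 - ζ / siteFreqSq d m * d| := by
    rw [denom, hs, ← Real.norm_eq_abs, ← Complex.norm_real]
    simp
  have hk : invCovEig m (0 : Site d L) = m ^ 2 := by
    simp [invCovEig, hs, siteFreqSq]
  rw [hd, hk, sq_abs, infiniteVolumeValue, siteFreqSq]
  field_simp

end TranslationInvariantPart

/-! ### Momentum-space bounds from absolute sums in position space. -/

section MomentumBounds

variable {d L : ℕ} [NeZero L]

theorem norm_dft (p x : Site d L) : ‖dft d L p x‖ = (Real.sqrt ((L : ℝ) ^ d))⁻¹ := by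
  rw [dft_apply, norm_mul, Complex.norm_conj, norm_wave, mul_one, Complex.norm_real,
    Real.norm_of_nonneg (by positivity)]

theorem sqrt_volume_inv_sq : (Real.sqrt ((L : ℝ) ^ d))⁻¹ ^ 2 = ((L : ℝ) ^ d)⁻¹ := by
  rw [inv_pow, Real.sq_sqrt (by positivity)]

theorem norm_dft_mul_apply_le (B : Matrix (Site d L) (Site d L) ℝ) (p y : Site d L) :
    ‖(dft d L * B.map (fun r : ℝ => (r : ℂ))) p y‖ ≤
      (Real.sqrt ((L : ℝ) ^ d))⁻¹ * ∑ x, |B x y| := by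
  rw [Matrix.mul_apply, Finset.mul_sum]
  refine norm_sum_le_of_le _ fun x _ => ?_
  rw [norm_mul, norm_dft, Matrix.map_apply, Complex.norm_real, Real.norm_eq_abs]

theorem norm_momentumRep_apply_le (B : Matrix (Site d L) (Site d L) ℝ) (p q : Site d L) :
    ‖momentumRep B p q‖ ≤ ((L : ℝ) ^ d)⁻¹ * ∑ x, ∑ y, |B x y| := by
  rw [momentumRep, Matrix.mul_apply, Finset.sum_comm, Finset.mul_sum]
  refine norm_sum_le_of_le _ fun y _ => ?_
  rw [norm_mul, Matrix.conjTranspose_apply, norm_star, norm_dft, ← sqrt_volume_inv_sq, sq,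
    mul_right_comm]
  exact mul_le_mul_of_nonneg_right (norm_dft_mul_apply_le B p y) (by positivity)

/-- The right Fourier factor is unitary and preserves row ℓ² norms. The left one bounds each entry
by L^{-d/2} times a column sum; one of the two column sums is then replaced by a. -/
theorem sum_sq_momentumRep_row_le (B : Matrix (Site d L) (Site d L) ℝ) {a : ℝ}
    (ha : ∀ y, ∑ x, |B x y| ≤ a) (p : Site d L) :
    ∑ q, ‖momentumRep B p q‖ ^ 2 ≤ ((L : ℝ) ^ d)⁻¹ * (a * ∑ x, ∑ y, |B x y|) := by
  have h1 : ∑ q, ‖momentumRep B p q‖ ^ 2 =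
      ∑ y, ‖(dft d L * B.map (fun r : ℝ => (r : ℂ))) p y‖ ^ 2 := by
    have h : momentumRep B * (momentumRep B)ᴴ = (dft d L * B.map (fun r : ℝ => (r : ℂ))) *
        (dft d L * B.map (fun r : ℝ => (r : ℂ)))ᴴ := by
      rw [momentumRep, Matrix.conjTranspose_mul _ (dft d L)ᴴ, Matrix.conjTranspose_conjTranspose,
        Matrix.mul_assoc, ← Matrix.mul_assoc (dft d L)ᴴ, conjTranspose_mul_dft, one_mul]
    have := congrFun (congrFun h p) p
    rw [mul_conjTranspose_apply_self, mul_conjTranspose_apply_self] at this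
    exact_mod_cast this
  rw [h1, Finset.sum_comm, Finset.mul_sum, Finset.mul_sum]
  refine Finset.sum_le_sum fun y _ => ?_
  have h0 : 0 ≤ ∑ x, |B x y| := Finset.sum_nonneg fun x _ => abs_nonneg _
  calc _ ≤ ((Real.sqrt ((L : ℝ) ^ d))⁻¹ * ∑ x, |B x y|) ^ 2 :=
        pow_le_pow_left₀ (norm_nonneg _) (norm_dft_mul_apply_le B p y) 2
    _ = ((L : ℝ) ^ d)⁻¹ * ((∑ x, |B x y|) * ∑ x, |B x y|) := by
        rw [mul_pow, sqrt_volume_inv_sq, sq]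
    _ ≤ _ := by gcongr; exact ha y

theorem sum_sq_momentumRep_col_le (B : Matrix (Site d L) (Site d L) ℝ) {a : ℝ}
    (ha : ∀ x, ∑ y, |B x y| ≤ a) (q : Site d L) :
    ∑ p, ‖momentumRep B p q‖ ^ 2 ≤ ((L : ℝ) ^ d)⁻¹ * (a * ∑ x, ∑ y, |B x y|) := by
  have h := sum_sq_momentumRep_row_le Bᵀ (a := a) ha q
  rw [momentumRep_transpose, Finset.sum_comm] at h
  simpa [Matrix.conjTranspose_apply] using h

end MomentumBounds

/-! ### The boundary correction and its size. -/

section Boundary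

variable {d L : ℕ} [NeZero L]

/-- The correction to the translation invariant sweep, supported at the boundary. -/
noncomputable def boundaryPart (sites : List (Site d L)) : Matrix (Site d L) (Site d L) ℝ :=
  updatedPart sites - backwardPart d L

/-- The links that cross the boundary of the sweep. -/
def boundaryLinks (start x y : Site d L) : ℝ :=
  ∑ μ : Fin d, ((if x + unitVec d L μ = y ∧ x μ + 1 = start μ then 1 else 0) +
    (if x - unitVec d L μ = y ∧ x μ = start μ then 1 else 0))

/-- The sweep deviates from the backward-neighbour rule in two ways: a forward neighbour is already
updated, or a backward neighbour is not yet updated. The ordering condition, applied at y or at x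
respectively, allows this only across the boundary. -/
theorem abs_boundaryPart_le {start : Site d L} {sites : List (Site d L)}
    (h : IsLexSweep start sites) (x y : Site d L) :
    |boundaryPart sites x y| ≤ boundaryLinks start x y := by
  have e : boundaryPart sites x y = ∑ μ : Fin d,
      ((if x + unitVec d L μ = y ∧ sites.idxOf y < sites.idxOf x then 1 else 0) -
        (if x - unitVec d L μ = y ∧ ¬ sites.idxOf y < sites.idxOf x then 1 else 0)) := by
    simp only [boundaryPart, updatedPart, backwardPart, shift, adjacency, Matrix.sub_apply,
      Matrix.of_apply, Matrix.sum_apply, ← sub_eq_add_neg]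
    by_cases hlt : sites.idxOf y < sites.idxOf x
    · simp only [hlt, if_true, ← Finset.sum_sub_distrib]
      simp
    · simp only [hlt, if_false]
      simp
  rw [e, boundaryLinks]
  refine (Finset.abs_sum_le_sum_abs _ _).trans (Finset.sum_le_sum fun μ _ => ?_)
  refine (abs_sub _ _).trans (add_le_add ?_ ?_)
  · by_cases h1 : x + unitVec d L μ = y ∧ sites.idxOf y < sites.idxOf x
    · have h2 : x μ + 1 = start μ := by
        by_contra hne
        have := h.before y μ (by rw [← h1.1]; simpa [unitVec] using hne)
        rw [← h1.1, add_sub_cancel_right, h1.1] at this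
        exact this.not_gt h1.2
      rw [if_pos h1, if_pos ⟨h1.1, h2⟩, abs_one]
    · rw [if_neg h1, abs_zero]
      split_ifs <;> norm_num
  · by_cases h1 : x - unitVec d L μ = y ∧ ¬ sites.idxOf y < sites.idxOf x
    · have h2 : x μ = start μ := by
        by_contra hne
        have := h.before x μ hne
        rw [h1.1] at this
        exact h1.2 this
      rw [if_pos h1, if_pos ⟨h1.1, h2⟩, abs_one]
    · rw [if_neg h1, abs_zero]
      split_ifs <;> norm_num

theorem sum_boundaryLinks_right (start x : Site d L) :
    ∑ y, boundaryLinks start x y =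
      ∑ μ : Fin d, ((if x μ + 1 = start μ then 1 else 0) + (if x μ = start μ then 1 else 0)) := by
  simp only [boundaryLinks]
  rw [Finset.sum_comm]
  refine Finset.sum_congr rfl fun μ _ => ?_
  simp [Finset.sum_add_distrib, ite_and]

theorem sum_boundaryLinks_right_le (start x : Site d L) :
    ∑ y, boundaryLinks start x y ≤ 2 * d := by
  rw [sum_boundaryLinks_right]
  refine (Finset.sum_le_card_nsmul _ _ 2 fun μ _ => ?_).trans (by simp [mul_comm])
  split_ifs <;> norm_num

theorem sum_boundaryLinks_left_le (start y : Site d L) :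
    ∑ x, boundaryLinks start x y ≤ 2 * d := by
  simp only [boundaryLinks]
  rw [Finset.sum_comm]
  refine (Finset.sum_le_card_nsmul _ _ 2 fun μ _ => ?_).trans (by simp [mul_comm])
  rw [Finset.sum_add_distrib, show (2 : ℝ) = 1 + 1 by norm_num]
  refine add_le_add ?_ ?_
  · calc _ ≤ ∑ x : Site d L, if x = y - unitVec d L μ then (1 : ℝ) else 0 := by
          refine Finset.sum_le_sum fun x _ => ?_
          simp only [eq_sub_iff_add_eq]
          split_ifs with h1 h2 <;> first | exact absurd h1.1 h2 | norm_num
      _ = 1 := by simp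
  · calc _ ≤ ∑ x : Site d L, if x = y + unitVec d L μ then (1 : ℝ) else 0 := by
          refine Finset.sum_le_sum fun x _ => ?_
          simp only [← sub_eq_iff_eq_add]
          split_ifs with h1 h2 <;> first | exact absurd h1.1 h2 | norm_num
      _ = 1 := by simp

theorem sum_ite_coord_eq (μ : Fin d) (c : ZMod L) :
    ∑ x : Site d L, (if x μ = c then (1 : ℝ) else 0) = (L : ℝ) ^ d / L := by
  have h : Finset.card (Finset.univ.filter fun x : Site d L => x μ = c) = L ^ (d - 1) := by
    have := Fintype.card_filter_piFinset_const_eq_of_mem (Finset.univ : Finset (ZMod L)) μ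
      (Finset.mem_univ c)
    simpa [ZMod.card] using this
  -- The direction μ forces d ≥ 1, so the natural subtraction is not truncated.
  have hd : d = (d - 1) + 1 := by have := μ.pos; omega
  have hL : (L : ℝ) ≠ 0 := NeZero.ne _
  rw [Finset.sum_boole, h, eq_div_iff hL]
  push_cast
  rw [← pow_succ, ← hd]

theorem sum_sum_boundaryLinks (start : Site d L) :
    ∑ x, ∑ y, boundaryLinks start x y = 2 * d * ((L : ℝ) ^ d / L) := by
  simp only [sum_boundaryLinks_right]
  rw [Finset.sum_comm]
  have : ∀ μ : Fin d, ∑ x : Site d L, ((if x μ + 1 = start μ then (1 : ℝ) else 0) +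
      (if x μ = start μ then 1 else 0)) = 2 * ((L : ℝ) ^ d / L) := fun μ => by
    simp only [← eq_sub_iff_add_eq]
    rw [Finset.sum_add_distrib, sum_ite_coord_eq, sum_ite_coord_eq]
    ring
  simp only [this]
  simp
  ring

variable {start : Site d L} {sites : List (Site d L)}

theorem sum_abs_boundaryPart_right_le (h : IsLexSweep start sites) (x : Site d L) :
    ∑ y, |boundaryPart sites x y| ≤ 2 * d :=
  (Finset.sum_le_sum fun y _ => abs_boundaryPart_le h x y).trans
    (sum_boundaryLinks_right_le start x)

theorem sum_abs_boundaryPart_left_le (h : IsLexSweep start sites) (y : Site d L) :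
    ∑ x, |boundaryPart sites x y| ≤ 2 * d :=
  (Finset.sum_le_sum fun x _ => abs_boundaryPart_le h x y).trans (sum_boundaryLinks_left_le start y)

theorem sum_sum_abs_boundaryPart_le (h : IsLexSweep start sites) :
    ((L : ℝ) ^ d)⁻¹ * ∑ x, ∑ y, |boundaryPart sites x y| ≤ 2 * d / L := by
  have hV : (0 : ℝ) < (L : ℝ) ^ d := pow_pos (Nat.cast_pos.2 (NeZero.pos L)) d
  rw [inv_mul_le_iff₀ hV]
  refine (Finset.sum_le_sum fun x _ => Finset.sum_le_sum fun y _ =>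
    abs_boundaryPart_le h x y).trans ?_
  rw [sum_sum_boundaryLinks]
  apply le_of_eq
  ring

theorem norm_momentumRep_boundaryPart_le (h : IsLexSweep start sites) (p q : Site d L) :
    ‖momentumRep (boundaryPart sites) p q‖ ≤ 2 * d / L :=
  (norm_momentumRep_apply_le _ p q).trans (sum_sum_abs_boundaryPart_le h)

theorem sum_sq_boundaryPart_row_le (h : IsLexSweep start sites) (p : Site d L) :
    ∑ q, ‖momentumRep (boundaryPart sites) p q‖ ^ 2 ≤ (2 * d) ^ 2 / L := by
  refine (sum_sq_momentumRep_row_le _ (sum_abs_boundaryPart_left_le h) p).trans ?_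
  have := mul_le_mul_of_nonneg_left (sum_sum_abs_boundaryPart_le h)
    (show (0 : ℝ) ≤ 2 * d by positivity)
  calc _ = 2 * (d : ℝ) * (((L : ℝ) ^ d)⁻¹ * ∑ x, ∑ y, |boundaryPart sites x y|) := by ring
    _ ≤ _ := this
    _ = _ := by ring

theorem sum_sq_boundaryPart_col_le (h : IsLexSweep start sites) (q : Site d L) :
    ∑ p, ‖momentumRep (boundaryPart sites) p q‖ ^ 2 ≤ (2 * d) ^ 2 / L := by
  refine (sum_sq_momentumRep_col_le _ (sum_abs_boundaryPart_right_le h) q).trans ?_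
  have := mul_le_mul_of_nonneg_left (sum_sum_abs_boundaryPart_le h)
    (show (0 : ℝ) ≤ 2 * d by positivity)
  calc _ = 2 * (d : ℝ) * (((L : ℝ) ^ d)⁻¹ * ∑ x, ∑ y, |boundaryPart sites x y|) := by ring
    _ ≤ _ := this
    _ = _ := by ring

end Boundary

/-! ### The O(1/L) estimate for the quadratic update matrix, and perturbation of inverses. -/

section FiniteVolumeCorrection

variable {d L : ℕ} [NeZero L] {m ζ : ℝ} {start : Site d L} {sites : List (Site d L)}

theorem smul_diagonal_sub_momentumRep_updatedPart (m ζ : ℝ) (sites : List (Site d L)) :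
    1 - ((ζ / siteFreqSq d m : ℝ) : ℂ) • momentumRep (updatedPart sites) =
      Matrix.diagonal (denom m ζ) -
        ((ζ / siteFreqSq d m : ℝ) : ℂ) • momentumRep (boundaryPart sites) := by
  have h : Matrix.diagonal (denom m ζ) = (1 : Matrix (Site d L) (Site d L) ℂ) -
      ((ζ / siteFreqSq d m : ℝ) : ℂ) • momentumRep (backwardPart d L) := by
    rw [momentumRep_backwardPart, ← Matrix.diagonal_smul, ← Matrix.diagonal_one,
      Matrix.diagonal_sub]
    rfl
  rw [h, boundaryPart, momentumRep_sub, smul_sub]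
  abel

theorem diagonal_inv_denom_mul (hm : 0 < m) (hζ0 : 0 < ζ) (hζ2 : ζ < 2) :
    (Matrix.diagonal fun p : Site d L => (denom m ζ p)⁻¹) * Matrix.diagonal (denom m ζ) = 1 := by
  rw [Matrix.diagonal_mul_diagonal, ← Matrix.diagonal_one]
  congr 1
  ext p
  exact inv_mul_cancel₀ (denom_ne_zero hm hζ0 hζ2 p)

theorem resolvent_sub_eq (hm : 0 < m) (hζ0 : 0 < ζ) (hζ2 : ζ < 2)
    (hn : sites.Nodup) (hc : ∀ x, x ∈ sites) :
    resolvent m ζ sites - (Matrix.diagonal fun p => (denom m ζ p)⁻¹) =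
      ((ζ / siteFreqSq d m : ℝ) : ℂ) • ((Matrix.diagonal fun p => (denom m ζ p)⁻¹) *
        (momentumRep (boundaryPart sites) * resolvent m ζ sites)) := by
  have hW := one_sub_updatedPart_mul_resolvent hm hζ0 hζ2 hn hc
  rw [smul_diagonal_sub_momentumRep_updatedPart] at hW
  have h1 := diagonal_inv_denom_mul (d := d) (L := L) hm hζ0 hζ2
  have h2 := congrArg (fun A => (Matrix.diagonal fun p => (denom m ζ p)⁻¹) * A) hW
  simp only [mul_one] at h2
  rw [← Matrix.mul_assoc, Matrix.mul_sub, h1, Matrix.sub_mul, one_mul] at h2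
  simp only [Matrix.smul_mul, Matrix.mul_smul, Matrix.mul_assoc] at h2
  rw [sub_eq_iff_eq_add] at h2 ⊢
  rw [add_comm]
  exact h2

/-- The resolvent identity in the other order. `resolvent_sub_eq` expresses M - M^D through BG; this
one expands BG once more, with B on both sides of G. -/
theorem resolvent_sub_eq' (hm : 0 < m) (hζ0 : 0 < ζ) (hζ2 : ζ < 2)
    (hn : sites.Nodup) (hc : ∀ x, x ∈ sites) :
    resolvent m ζ sites - (Matrix.diagonal fun p => (denom m ζ p)⁻¹) =
      ((ζ / siteFreqSq d m : ℝ) : ℂ) • (resolvent m ζ sites * momentumRep (boundaryPart sites) *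
        (Matrix.diagonal fun p => (denom m ζ p)⁻¹)) := by
  have hW := mul_eq_one_comm.1 (one_sub_updatedPart_mul_resolvent hm hζ0 hζ2 hn hc)
  rw [smul_diagonal_sub_momentumRep_updatedPart] at hW
  have h1 := mul_eq_one_comm.1 (diagonal_inv_denom_mul (d := d) (L := L) hm hζ0 hζ2)
  have h2 := congrArg (fun A => A * (Matrix.diagonal fun p => (denom m ζ p)⁻¹)) hW
  simp only [one_mul] at h2
  rw [Matrix.mul_sub, Matrix.sub_mul, Matrix.mul_assoc _ (Matrix.diagonal (denom m ζ)), h1,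
    mul_one] at h2
  simp only [Matrix.smul_mul, Matrix.mul_smul] at h2
  rw [sub_eq_iff_eq_add] at h2 ⊢
  rw [add_comm]
  exact h2

theorem momM_sub_momMD_apply (hm : 0 < m) (hζ0 : 0 < ζ) (hζ2 : ζ < 2) (hL : 2 ≤ L)
    (hn : sites.Nodup) (hc : ∀ x, x ∈ sites) (p q : Site d L) :
    (momM m ζ sites - momMD d L m ζ) p q =
      -((ζ / siteFreqSq d m : ℝ) ^ 2 * (denom m ζ p)⁻¹ * (invCovEig m q : ℂ) *
        (momentumRep (boundaryPart sites) * resolvent m ζ sites) p q) := by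
  have h : momM m ζ sites - momMD d L m ζ =
      -((resolvent m ζ sites - (Matrix.diagonal fun p => (denom m ζ p)⁻¹)) *
        (((ζ / siteFreqSq d m : ℝ) : ℂ) • momentumRep (invCov d L m))) := by
    rw [momM_eq hm hζ0 hζ2 hL hn hc, momMD_eq hm hζ0 hζ2, Matrix.sub_mul]
    abel
  rw [h, resolvent_sub_eq hm hζ0 hζ2 hn hc, momentumRep_invCov, Matrix.neg_apply,
    Matrix.mul_smul, Matrix.smul_apply, Matrix.mul_diagonal, Matrix.smul_apply,
    Matrix.diagonal_mul, smul_eq_mul, smul_eq_mul]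
  ring

theorem norm_inv_denom_le (hm : 0 < m) (hζ0 : 0 < ζ) (hζ2 : ζ < 2) (p : Site d L) :
    ‖(denom m ζ p)⁻¹‖ ≤ (1 - ζ / siteFreqSq d m * d)⁻¹ := by
  rw [norm_inv]
  exact inv_anti₀ (by linarith [mul_dim_lt_one d hm hζ2]) (le_norm_denom hm hζ0 p)

/-- The bound on the deviation of the update matrix from its translation invariant part. -/
noncomputable def deviationScale (d : ℕ) (m ζ : ℝ) : ℝ :=
  (ζ / siteFreqSq d m) ^ 2 * (1 - ζ / siteFreqSq d m * d)⁻¹ * (m ^ 2 + 4 * d)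

theorem deviationScale_nonneg (hm : 0 < m) (hζ2 : ζ < 2) : 0 ≤ deviationScale d m ζ := by
  have := mul_dim_lt_one d hm hζ2
  have : 0 ≤ (1 - ζ / siteFreqSq d m * d)⁻¹ := inv_nonneg.2 (by linarith)
  unfold deviationScale
  positivity

theorem norm_momM_sub_momMD_apply_le (hm : 0 < m) (hζ0 : 0 < ζ) (hζ2 : ζ < 2) (hL : 2 ≤ L)
    (hn : sites.Nodup) (hc : ∀ x, x ∈ sites) (p q : Site d L) :
    ‖(momM m ζ sites - momMD d L m ζ) p q‖ ≤ deviationScale d m ζ *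
        ‖(momentumRep (boundaryPart sites) * resolvent m ζ sites) p q‖ := by
  rw [momM_sub_momMD_apply hm hζ0 hζ2 hL hn hc, norm_neg, norm_mul, norm_mul, norm_mul, norm_pow,
    Complex.norm_real, Complex.norm_real, Real.norm_of_nonneg (invCovEig_pos hm q).le,
    Real.norm_of_nonneg (div_siteFreqSq_pos d hm hζ0).le, deviationScale]
  have h1 := norm_inv_denom_le hm hζ0 hζ2 p
  have h2 := invCovEig_le m q
  have h3 := (invCovEig_pos hm q).le
  have h4 := (norm_nonneg _).trans h1
  gcongr

/-- The row bound on BG alone gives only L^{-1/2} for an entry. After one more expansion the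
diagonal entry is 1/`denom` times B_pp + t(BGB)_pp. Here B_pp is at most 2d/L, and Cauchy–Schwarz
bounds (BGB)_pp by a row norm of BG times a column norm of B, each O(L^{-1/2}). -/
theorem norm_boundaryPart_mul_resolvent_diag_le (hm : 0 < m) (hζ0 : 0 < ζ) (hζ2 : ζ < 2)
    (hL : 2 ≤ L) (h : IsLexSweep start sites) (p : Site d L) :
    ‖(momentumRep (boundaryPart sites) * resolvent m ζ sites) p p‖ ≤
      (1 - ζ / siteFreqSq d m * d)⁻¹ * (2 * d + ζ / siteFreqSq d m *
        (Real.sqrt ((noiseAmp d m ζ ^ 2 * m ^ 2)⁻¹) * (2 * d) ^ 2)) / L := by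
  set B := momentumRep (boundaryPart sites)
  set G := resolvent m ζ sites
  have hG : G = (Matrix.diagonal fun p => (denom m ζ p)⁻¹) + ((ζ / siteFreqSq d m : ℝ) : ℂ) •
      (G * B * (Matrix.diagonal fun p => (denom m ζ p)⁻¹)) := by
    rw [← resolvent_sub_eq' hm hζ0 hζ2 h.nodup h.complete]
    abel
  have e : (B * G) p p = (denom m ζ p)⁻¹ *
      (B p p + ((ζ / siteFreqSq d m : ℝ) : ℂ) * (B * G * B) p p) := by
    conv_lhs => rw [hG]
    rw [Matrix.mul_add, Matrix.mul_smul, Matrix.add_apply, Matrix.smul_apply, ← Matrix.mul_assoc,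
      ← Matrix.mul_assoc, Matrix.mul_diagonal, Matrix.mul_diagonal, smul_eq_mul]
    ring
  have hγ : 0 ≤ (noiseAmp d m ζ ^ 2 * m ^ 2)⁻¹ := by positivity
  have hBGB : ‖(B * G * B) p p‖ ≤
      Real.sqrt ((noiseAmp d m ζ ^ 2 * m ^ 2)⁻¹) * (2 * d) ^ 2 / L := by
    rw [Matrix.mul_apply]
    refine (norm_sum_le _ _).trans ?_
    simp only [norm_mul]
    refine (Real.sum_mul_le_sqrt_mul_sqrt _ _ _).trans ?_
    have h1 : ∑ q, ‖(B * G) p q‖ ^ 2 ≤ (noiseAmp d m ζ ^ 2 * m ^ 2)⁻¹ * ((2 * d) ^ 2 / L) :=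
      (row_mul_resolvent_le hm hζ0 hζ2 hL h.nodup h.complete B p).trans
        (mul_le_mul_of_nonneg_left (sum_sq_boundaryPart_row_le h p) hγ)
    calc _ ≤ Real.sqrt ((noiseAmp d m ζ ^ 2 * m ^ 2)⁻¹ * ((2 * d) ^ 2 / L)) *
          Real.sqrt ((2 * d) ^ 2 / L) :=
          mul_le_mul (Real.sqrt_le_sqrt h1) (Real.sqrt_le_sqrt (sum_sq_boundaryPart_col_le h p))
            (Real.sqrt_nonneg _) (Real.sqrt_nonneg _)
      _ = _ := by
          rw [Real.sqrt_mul hγ, mul_assoc, Real.mul_self_sqrt (by positivity), mul_div_assoc]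
  have ht := (div_siteFreqSq_pos d hm hζ0).le
  rw [e, norm_mul, mul_div_assoc]
  have hinv := norm_inv_denom_le hm hζ0 hζ2 p
  refine mul_le_mul hinv ?_ (norm_nonneg _) ((norm_nonneg _).trans hinv)
  refine (norm_add_le _ _).trans ?_
  rw [norm_mul, Complex.norm_real, Real.norm_of_nonneg ht, add_div, mul_div_assoc (ζ / _)]
  exact add_le_add (norm_momentumRep_boundaryPart_le h p p) (mul_le_mul_of_nonneg_left hBGB ht)

theorem abs_normSq_sub_le (a b : ℂ) : |‖a‖ ^ 2 - ‖b‖ ^ 2| ≤ ‖a - b‖ ^ 2 + 2 * ‖b‖ * ‖a - b‖ := by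
  have h1 : |‖a‖ - ‖b‖| ≤ ‖a - b‖ := abs_norm_sub_norm_le a b
  have h2 : ‖a‖ ≤ ‖a - b‖ + ‖b‖ := by simpa using norm_add_le (a - b) b
  rw [sq_sub_sq, abs_mul, abs_of_nonneg (by positivity : 0 ≤ ‖a‖ + ‖b‖)]
  nlinarith [norm_nonneg a, norm_nonneg b, norm_nonneg (a - b), abs_nonneg (‖a‖ - ‖b‖)]

/-- The quadratic update matrix is diagonal up to corrections of order `1 / L`. -/
theorem norm_absSq_sub_le (d : ℕ) (hm : 0 < m) (hζ0 : 0 < ζ) (hζ2 : ζ < 2) :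
    ∃ C : ℝ, 0 ≤ C ∧ ∀ (L : ℕ) [NeZero L], 2 ≤ L → ∀ (start : Site d L)
      (sites : List (Site d L)), IsLexSweep start sites →
        ‖absSq (momM m ζ sites) - absSq (momMD d L m ζ)‖ ≤ C / L := by
  set c₁ := deviationScale d m ζ ^ 2 * ((noiseAmp d m ζ ^ 2 * m ^ 2)⁻¹ * (2 * d) ^ 2) with hc₁
  set c₂ := deviationScale d m ζ * ((1 - ζ / siteFreqSq d m * d)⁻¹ * (2 * d + ζ / siteFreqSq d m *
        (Real.sqrt ((noiseAmp d m ζ ^ 2 * m ^ 2)⁻¹) * (2 * d) ^ 2))) with hc₂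
  have hs := deviationScale_nonneg (d := d) hm hζ2
  have ht := (div_siteFreqSq_pos d hm hζ0).le
  have hi : 0 ≤ (1 - ζ / siteFreqSq d m * d)⁻¹ := by
    have := mul_dim_lt_one d hm hζ2
    exact inv_nonneg.2 (by linarith)
  -- c₁ bounds L times the row sum of |E|²; 2c₂ bounds L times the cross term, using |M^D| ≤ 1.
  refine ⟨c₁ + 2 * c₂, by positivity, fun L _ hL start sites h => ?_⟩
  have hrow : ∀ p, ∑ q, ‖(absSq (momM m ζ sites) - absSq (momMD d L m ζ)) p q‖ ≤
      (c₁ + 2 * c₂) / L := by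
    intro p
    have hE := fun q => norm_momM_sub_momMD_apply_le hm hζ0 hζ2 hL h.nodup h.complete p q
    have h1 : ∑ q, ‖(momM m ζ sites - momMD d L m ζ) p q‖ ^ 2 ≤ c₁ / L := by
      calc _ ≤ ∑ q, deviationScale d m ζ ^ 2 *
            ‖(momentumRep (boundaryPart sites) * resolvent m ζ sites) p q‖ ^ 2 :=
            Finset.sum_le_sum fun q _ => by
              rw [← mul_pow]
              exact pow_le_pow_left₀ (norm_nonneg _) (hE q) 2
        _ ≤ deviationScale d m ζ ^ 2 * ((noiseAmp d m ζ ^ 2 * m ^ 2)⁻¹ * ((2 * d) ^ 2 / L)) := by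
            rw [← Finset.mul_sum]
            refine mul_le_mul_of_nonneg_left ?_ (by positivity)
            exact (row_mul_resolvent_le hm hζ0 hζ2 hL h.nodup h.complete _ p).trans
              (mul_le_mul_of_nonneg_left (sum_sq_boundaryPart_row_le h p) (by positivity))
        _ = c₁ / L := by rw [hc₁]; ring
    have h2 : ‖(momM m ζ sites - momMD d L m ζ) p p‖ ≤ c₂ / L := by
      refine (hE p).trans ?_
      rw [hc₂, mul_div_assoc]
      exact mul_le_mul_of_nonneg_left
        (norm_boundaryPart_mul_resolvent_diag_le hm hζ0 hζ2 hL h p) hs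
    have h3 : ∀ q, ‖(absSq (momM m ζ sites) - absSq (momMD d L m ζ)) p q‖ ≤
        ‖(momM m ζ sites - momMD d L m ζ) p q‖ ^ 2 +
          2 * ‖momMD d L m ζ p q‖ * ‖(momM m ζ sites - momMD d L m ζ) p q‖ := fun q => by
      rw [Matrix.sub_apply, absSq_apply, absSq_apply, ← Complex.ofReal_sub, Complex.norm_real]
      exact abs_normSq_sub_le _ _
    refine (Finset.sum_le_sum fun q _ => h3 q).trans ?_
    rw [Finset.sum_add_distrib, add_div]
    refine add_le_add h1 ?_
    -- Since M^D is diagonal, only the diagonal entry of E appears to first order.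
    rw [Finset.sum_eq_single p (fun q _ hq => by rw [momMD_apply_ne hq.symm]; simp) (by simp)]
    have h4 := norm_momMD_le hm hζ0 hζ2 p
    have h5 := mul_le_mul h4 h2 (norm_nonneg _) zero_le_one
    rw [mul_div_assoc]
    linarith
  rw [Matrix.linfty_opNorm_def]
  have hnn : 0 ≤ (c₁ + 2 * c₂) / L := by positivity
  rw [← NNReal.coe_mk _ hnn, NNReal.coe_le_coe]
  refine Finset.sup_le fun p _ => ?_
  rw [← NNReal.coe_le_coe]
  push_cast
  exact hrow p

theorem norm_inv_sub_inv_le {n : Type*} [Fintype n] [DecidableEq n] {X Y : Matrix n n ℂ}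
    (hX : IsUnit X) (hY : IsUnit Y) {κ ε : ℝ} (hκ : ‖Y⁻¹‖ ≤ κ) (hε : ‖X - Y‖ ≤ ε)
    (h : ε * κ ≤ 1 / 2) : ‖X⁻¹ - Y⁻¹‖ ≤ 2 * κ * ε * κ := by
  have hX' := (Matrix.isUnit_iff_isUnit_det X).1 hX
  have hY' := (Matrix.isUnit_iff_isUnit_det Y).1 hY
  have e : X⁻¹ - Y⁻¹ = -(X⁻¹ * (X - Y) * Y⁻¹) := by
    rw [Matrix.mul_sub, Matrix.nonsing_inv_mul _ hX', Matrix.sub_mul, one_mul,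
      Matrix.mul_assoc, Matrix.mul_nonsing_inv _ hY', mul_one]
    abel
  have hκ0 := (norm_nonneg _).trans hκ
  have hε0 := (norm_nonneg _).trans hε
  have h1 : ‖X⁻¹ - Y⁻¹‖ ≤ ‖X⁻¹‖ * ε * κ := by
    rw [e, norm_neg]
    refine (Matrix.linfty_opNorm_mul _ _).trans (mul_le_mul ?_ hκ (norm_nonneg _) (by positivity))
    exact (Matrix.linfty_opNorm_mul _ _).trans (mul_le_mul_of_nonneg_left hε (norm_nonneg _))
  -- Self-consistent bound: ‖X⁻¹‖ ≤ ‖X⁻¹‖εκ + κ, and εκ ≤ 1/2 lets the first term be absorbed.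
  have h2 : ‖X⁻¹‖ ≤ 2 * κ := by
    have h3 : ‖X⁻¹‖ ≤ ‖X⁻¹ - Y⁻¹‖ + ‖Y⁻¹‖ := by simpa using norm_add_le (X⁻¹ - Y⁻¹) Y⁻¹
    nlinarith [norm_nonneg X⁻¹]
  exact h1.trans (by gcongr)

end FiniteVolumeCorrection

/-! ### Translated sweeps and the average over the starting point. -/

section Translations

variable {d L : ℕ} [NeZero L] {m ζ : ℝ}

theorem shift_mul_apply (v : Site d L) (A : Matrix (Site d L) (Site d L) ℝ) (x y : Site d L) :
    (shift v * A) x y = A (x + v) y := by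
  rw [Matrix.mul_apply]
  simp [shift]

theorem mul_shift_apply (v : Site d L) (A : Matrix (Site d L) (Site d L) ℝ) (x y : Site d L) :
    (A * shift v) x y = A x (y - v) := by
  rw [Matrix.mul_apply]
  simp [shift, ← eq_sub_iff_add_eq]

theorem shift_mul_shift_neg (v : Site d L) : shift v * shift (-v) = 1 := by
  ext x y
  rw [shift_mul_apply]
  simp [shift, Matrix.one_apply]

theorem localM_add (a z : Site d L) :
    localM m ζ (z + a) = shift (-a) * localM m ζ z * shift a := by
  ext x y
  rw [mul_shift_apply, shift_mul_apply, ← sub_eq_add_neg]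
  have h1 : ∀ e : Site d L, (x - a + e = y - a) = (x + e = y) := fun e => by
    rw [sub_add_eq_add_sub, sub_left_inj]
  have h2 : ∀ e : Site d L, (x - a - e = y - a) = (x - e = y) := fun e => by
    rw [sub_right_comm, sub_left_inj]
  simp only [localM, Matrix.of_apply, h1, h2, sub_left_inj, sub_eq_iff_eq_add (b := a) (c := z)]

theorem sweepM_translate (a : Site d L) (sites : List (Site d L)) :
    sweepM m ζ (translate a sites) = shift (-a) * sweepM m ζ sites * shift a := by
  have h : shift a * shift (-a) = 1 := shift_mul_shift_neg a
  induction sites with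
  | nil => simp [translate, sweepM, mul_eq_one_comm.1 h]
  | cons z l ih =>
    have e : translate a (z :: l) = (z + a) :: translate a l := rfl
    rw [e, sweepM, sweepM, ih, localM_add]
    calc _ = shift (-a) * sweepM m ζ l * (shift a * shift (-a)) * localM m ζ z * shift a := by
          simp only [Matrix.mul_assoc]
      _ = _ := by rw [h, mul_one, Matrix.mul_assoc (shift (-a))]

theorem momM_translate_apply (a : Site d L) (sites : List (Site d L)) (p q : Site d L) :
    momM m ζ (translate a sites) p q = wave (q - p) a * momM m ζ sites p q := by
  rw [momM, sweepM_translate, momentumRep_mul, momentumRep_mul, momentumRep_shift,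
    momentumRep_shift, Matrix.mul_diagonal, Matrix.diagonal_mul, sub_eq_add_neg, wave_add_left,
    wave_neg_left, wave_neg_right, momM]
  ring

/-- The phases of the two factors combine to a plane wave in a with momentum (p - q) - (r - s); its
average is the Kronecker delta. -/
theorem avgQuadM_apply (sites : List (Site d L)) (p q r s : Site d L) :
    avgQuadM m ζ sites (p, q) (r, s) =
      if p - q = r - s then conj (momM m ζ sites p r) * momM m ζ sites q s else 0 := by
  have h : ∀ a, conj (momM m ζ (translate a sites) p r) * momM m ζ (translate a sites) q s =
      wave ((p - q) - (r - s)) a * (conj (momM m ζ sites p r) * momM m ζ sites q s) := fun a => by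
    rw [momM_translate_apply, momM_translate_apply, map_mul, ← wave_neg_left,
      show (p - q) - (r - s) = -(r - p) + (s - q) by abel, wave_add_left]
    ring
  simp only [avgQuadM, Matrix.smul_apply, Matrix.sum_apply, Matrix.kroneckerMap_apply,
    Matrix.map_apply, smul_eq_mul, h]
  rw [← Finset.sum_mul, sum_wave]
  simp only [sub_eq_zero]
  split_ifs
  · rw [← mul_assoc, inv_mul_cancel₀ volume_ne_zero, one_mul]
  · simp

theorem sectorBlock_eq (sites : List (Site d L)) :
    sectorBlock m ζ sites = absSq (momM m ζ sites) := by
  ext p q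
  rw [sectorBlock, Matrix.submatrix_apply, avgQuadM_apply]
  simp [absSq, Matrix.hadamard_apply]

end Translations

/-! ### First and second moments of the Gaussian momenta. -/

section MomentumMoments

variable {d L : ℕ} [NeZero L]

instance : IsProbabilityMeasure (momentumLaw d L) := by
  unfold momentumLaw; infer_instance

theorem measurePreserving_coord (x : Site d L) :
    MeasurePreserving (fun π : Field d L => π x) (momentumLaw d L) (gaussianReal 0 1) :=
  measurePreserving_eval (fun _ : Site d L => gaussianReal 0 1) x

theorem memLp_coord (x : Site d L) : MemLp (fun π : Field d L => π x) 2 (momentumLaw d L) :=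
  (memLp_id_gaussianReal 2).comp_measurePreserving (measurePreserving_coord x)

theorem integrable_coord (x : Site d L) : Integrable (fun π : Field d L => π x) (momentumLaw d L) :=
  (memLp_coord x).integrable (by norm_num)

theorem integrable_coord_mul (x y : Site d L) :
    Integrable (fun π : Field d L => π x * π y) (momentumLaw d L) :=
  (memLp_coord x).integrable_mul (memLp_coord y)

theorem integral_coord (x : Site d L) : ∫ π : Field d L, π x ∂(momentumLaw d L) = 0 := by
  rw [momentumLaw, integral_comp_eval (μ := fun _ : Site d L => gaussianReal 0 1) (f := fun y => y)
    aestronglyMeasurable_id, integral_id_gaussianReal]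

theorem integral_coord_mul (x y : Site d L) :
    ∫ π : Field d L, π x * π y ∂(momentumLaw d L) = if x = y then 1 else 0 := by
  split_ifs with h
  · subst h
    have h2 := variance_id_gaussianReal (μ := 0) (v := 1)
    rw [variance_eq_integral aemeasurable_id] at h2
    simp only [id_eq, integral_id_gaussianReal, sub_zero, NNReal.coe_one] at h2
    simp only [← sq]
    rw [momentumLaw, integral_comp_eval (μ := fun _ : Site d L => gaussianReal 0 1)
      (f := fun y => y ^ 2) (by fun_prop), h2]
  · have hi : iIndepFun (fun (x : Site d L) (π : Field d L) => π x) (momentumLaw d L) :=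
      iIndepFun_pi (X := fun _ => id) fun _ => aemeasurable_id
    have := (hi.indepFun h).integral_fun_mul_eq_mul_integral (integrable_coord x).1
      (integrable_coord y).1
    rw [this, integral_coord, zero_mul]

theorem integrable_const_mul_coord (c : ℂ) (x : Site d L) :
    Integrable (fun π : Field d L => c * (π x : ℂ)) (momentumLaw d L) :=
  (integrable_coord x).ofReal.const_mul c

theorem integrable_const_mul_coord_mul (c : ℂ) (x y : Site d L) :
    Integrable (fun π : Field d L => c * ((π x * π y : ℝ) : ℂ)) (momentumLaw d L) :=
  (integrable_coord_mul x y).ofReal.const_mul c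

/-- A complex linear functional of the field. -/
noncomputable def linForm (b : Site d L → ℂ) (π : Field d L) : ℂ := ∑ x, b x * (π x : ℂ)

theorem integrable_linForm (b : Site d L → ℂ) : Integrable (linForm b) (momentumLaw d L) :=
  integrable_finsetSum _ fun x _ => integrable_const_mul_coord (b x) x

theorem integral_linForm (b : Site d L → ℂ) : ∫ π, linForm b π ∂(momentumLaw d L) = 0 := by
  unfold linForm
  rw [integral_finsetSum _ fun x _ => integrable_const_mul_coord (b x) x]
  refine Finset.sum_eq_zero fun x _ => ?_
  rw [integral_const_mul, integral_complex_ofReal, integral_coord]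
  simp

theorem linForm_mul (b b' : Site d L → ℂ) (π : Field d L) :
    linForm b π * linForm b' π = ∑ x, ∑ y, (b x * b' y) * ((π x * π y : ℝ) : ℂ) := by
  rw [linForm, linForm, Finset.sum_mul_sum]
  refine Finset.sum_congr rfl fun x _ => Finset.sum_congr rfl fun y _ => ?_
  push_cast
  ring

theorem integrable_linForm_mul (b b' : Site d L → ℂ) :
    Integrable (fun π => linForm b π * linForm b' π) (momentumLaw d L) := by
  simp only [linForm_mul]
  exact integrable_finsetSum _ fun x _ => integrable_finsetSum _ fun y _ =>
    integrable_const_mul_coord_mul _ x y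

theorem integral_linForm_mul (b b' : Site d L → ℂ) :
    ∫ π, linForm b π * linForm b' π ∂(momentumLaw d L) = ∑ x, b x * b' x := by
  simp only [linForm_mul]
  rw [integral_finsetSum _ fun x _ => integrable_finsetSum _ fun y _ =>
    integrable_const_mul_coord_mul _ x y]
  refine Finset.sum_congr rfl fun x _ => ?_
  rw [integral_finsetSum _ fun y _ => integrable_const_mul_coord_mul _ x y]
  have h : ∀ y, ∫ π : Field d L, b x * b' y * ((π x * π y : ℝ) : ℂ) ∂(momentumLaw d L) =
      b x * b' y * (if x = y then 1 else 0) := fun y => by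
    rw [integral_const_mul, integral_complex_ofReal, integral_coord_mul]
    split_ifs <;> simp
  simp only [h]
  simp

theorem affine_mul (u u' : ℂ) (b b' : Site d L → ℂ) (π : Field d L) :
    (u + linForm b π) * (u' + linForm b' π) =
      u * u' + (u * linForm b' π + u' * linForm b π + linForm b π * linForm b' π) := by
  ring

theorem integrable_affine_mul (u u' : ℂ) (b b' : Site d L → ℂ) :
    Integrable (fun π => (u + linForm b π) * (u' + linForm b' π)) (momentumLaw d L) := by
  simp only [affine_mul]
  exact (integrable_const _).add ((((integrable_linForm b').const_mul u).add
    ((integrable_linForm b).const_mul u')).add (integrable_linForm_mul b b'))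

theorem integral_affine_mul (u u' : ℂ) (b b' : Site d L → ℂ) :
    ∫ π, (u + linForm b π) * (u' + linForm b' π) ∂(momentumLaw d L) =
      u * u' + ∑ x, b x * b' x := by
  simp only [affine_mul]
  have h1 := (integrable_linForm b').const_mul u
  have h2 := (integrable_linForm b).const_mul u'
  have h3 := integrable_linForm_mul b b'
  have h12 : Integrable (fun π => u * linForm b' π + u' * linForm b π) (momentumLaw d L) :=
    h1.add h2
  have h123 : Integrable (fun π => u * linForm b' π + u' * linForm b π +
      linForm b π * linForm b' π) (momentumLaw d L) := h12.add h3
  rw [integral_add (integrable_const _) h123, integral_add h12 h3,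
    integral_add h1 h2]
  simp only [integral_const_mul, integral_linForm, integral_linForm_mul]
  simp

end MomentumMoments

/-! ### Action of a randomized sweep on quadratic observables. -/

section Transition

variable {d L : ℕ} [NeZero L] {m ζ : ℝ}

theorem fourier_mulVec (A : Matrix (Site d L) (Site d L) ℝ) (φ : Field d L) :
    fourier (A *ᵥ φ) = momentumRep A *ᵥ fourier φ := by
  have h : (fun x => ((A *ᵥ φ) x : ℂ)) = A.map (fun r : ℝ => (r : ℂ)) *ᵥ fun x => (φ x : ℂ) := by
    ext x
    simp [Matrix.mulVec, dotProduct]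
  rw [fourier, h, fourier, momentumRep, Matrix.mulVec_mulVec, Matrix.mulVec_mulVec,
    Matrix.mul_assoc _ _ (dft d L), conjTranspose_mul_dft, mul_one]

theorem fourier_add (φ ψ : Field d L) : fourier (φ + ψ) = fourier φ + fourier ψ := by
  rw [fourier, fourier, fourier, ← Matrix.mulVec_add]
  congr 1
  ext x
  simp

/-- The Fourier transform of the noise of a sweep, as a linear functional of the momenta. -/
theorem fourier_mulVec_eq_linForm (A : Matrix (Site d L) (Site d L) ℝ) (π : Field d L)
    (p : Site d L) :
    fourier (A *ᵥ π) p = linForm ((dft d L * A.map (fun r : ℝ => (r : ℂ))) p) π := by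
  have h : (fun x => ((A *ᵥ π) x : ℂ)) = A.map (fun r : ℝ => (r : ℂ)) *ᵥ fun x => (π x : ℂ) := by
    ext x
    simp [Matrix.mulVec, dotProduct]
  rw [fourier, h, Matrix.mulVec_mulVec]
  rfl

theorem conj_linForm (b : Site d L → ℂ) (π : Field d L) :
    conj (linForm b π) = linForm (fun x => conj (b x)) π := by
  simp [linForm]

theorem conj_fourier_mul_fourier_sweep (M P : Matrix (Site d L) (Site d L) ℝ) (φ π : Field d L)
    (p q : Site d L) :
    conj (fourier (M *ᵥ φ + P *ᵥ π) p) * fourier (M *ᵥ φ + P *ᵥ π) q =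
      (conj (fourier (M *ᵥ φ) p) +
        linForm (fun x => conj ((dft d L * P.map (fun r : ℝ => (r : ℂ))) p x)) π) *
      (fourier (M *ᵥ φ) q + linForm ((dft d L * P.map (fun r : ℝ => (r : ℂ))) q) π) := by
  rw [fourier_add, Pi.add_apply, Pi.add_apply, map_add, fourier_mulVec_eq_linForm P,
    fourier_mulVec_eq_linForm P, conj_linForm]

theorem integrable_conj_fourier_mul_fourier_sweep (M P : Matrix (Site d L) (Site d L) ℝ)
    (φ : Field d L) (p q : Site d L) :
    Integrable (fun π => conj (fourier (M *ᵥ φ + P *ᵥ π) p) * fourier (M *ᵥ φ + P *ᵥ π) q)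
      (momentumLaw d L) := by
  simp only [conj_fourier_mul_fourier_sweep]
  exact integrable_affine_mul _ _ _ _

/-- The momenta are kept in position space, giving the coefficients F P. White noise has identity
covariance, so the extra unitary factor in F P F† leaves the sum unchanged. -/
theorem sum_conj_momentumRep_mul (P : Matrix (Site d L) (Site d L) ℝ) (p q : Site d L) :
    ∑ x, conj ((dft d L * P.map (fun r : ℝ => (r : ℂ))) p x) *
        (dft d L * P.map (fun r : ℝ => (r : ℂ))) q x =
      ∑ r, conj (momentumRep P p r) * momentumRep P q r := by
  have h : momentumRep P * (momentumRep P)ᴴ = (dft d L * P.map (fun r : ℝ => (r : ℂ))) *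
      (dft d L * P.map (fun r : ℝ => (r : ℂ)))ᴴ := by
    rw [momentumRep, Matrix.conjTranspose_mul _ (dft d L)ᴴ, Matrix.conjTranspose_conjTranspose,
      Matrix.mul_assoc, ← Matrix.mul_assoc (dft d L)ᴴ, conjTranspose_mul_dft, one_mul]
  have h2 := congrFun (congrFun h q) p
  rw [Matrix.mul_apply, Matrix.mul_apply] at h2
  simp only [Matrix.conjTranspose_apply, Complex.star_def] at h2
  simp only [mul_comm (conj _)]
  exact h2.symm

theorem integral_conj_fourier_mul_fourier_sweep (M P : Matrix (Site d L) (Site d L) ℝ)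
    (φ : Field d L) (p q : Site d L) :
    ∫ π, conj (fourier (M *ᵥ φ + P *ᵥ π) p) * fourier (M *ᵥ φ + P *ᵥ π) q ∂(momentumLaw d L) =
      ∑ r, ∑ s, conj (momentumRep M p r) * momentumRep M q s *
        (conj (fourier φ r) * fourier φ s) +
      ∑ r, conj (momentumRep P p r) * momentumRep P q r := by
  simp only [conj_fourier_mul_fourier_sweep]
  rw [integral_affine_mul, sum_conj_momentumRep_mul, fourier_mulVec]
  congr 1
  simp only [Matrix.mulVec, dotProduct, map_sum, map_mul]
  rw [Finset.sum_mul_sum]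
  refine Finset.sum_congr rfl fun r _ => Finset.sum_congr rfl fun s _ => ?_
  ring

theorem transition_conj_fourier_mul_fourier (sites : List (Site d L)) (φ : Field d L)
    (p q : Site d L) :
    transition m ζ sites (fun ψ => conj (fourier ψ p) * fourier ψ q) φ =
      (∑ r : Site d L, ∑ s : Site d L,
        avgQuadM m ζ sites (p, q) (r, s) * (conj (fourier φ r) * fourier φ s)) +
      avgQuadP m ζ sites p q := by
  have hV : ∀ z : ℂ, ((L : ℝ) ^ d)⁻¹ • z = ((L : ℂ) ^ d)⁻¹ * z := fun z => by
    rw [Complex.real_smul]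
    push_cast
    rfl
  have e : ∀ r s, avgQuadM m ζ sites (p, q) (r, s) * (conj (fourier φ r) * fourier φ s) =
      ((L : ℂ) ^ d)⁻¹ * ∑ a, conj (momentumRep (sweepM m ζ (translate a sites)) p r) *
        momentumRep (sweepM m ζ (translate a sites)) q s *
          (conj (fourier φ r) * fourier φ s) := fun r s => by
    simp only [avgQuadM, Matrix.smul_apply, Matrix.sum_apply, smul_eq_mul, mul_assoc,
      Finset.sum_mul, Matrix.kroneckerMap_apply, Matrix.map_apply, momM]
  simp only [transition, integral_conj_fourier_mul_fourier_sweep, hV, e, ← Finset.mul_sum, avgQuadP,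
    momP]
  rw [Finset.sum_add_distrib, mul_add]
  refine congrArg₂ (· + ·) (congrArg _ ?_) rfl
  rw [Finset.sum_comm]
  refine Finset.sum_congr rfl fun r _ => ?_
  rw [Finset.sum_comm]

/-- The power of the Fourier mode `p`. -/
noncomputable def modePower (p : Site d L) (φ : Field d L) : ℝ := ‖fourier φ p‖ ^ 2

theorem ofReal_modePower (p : Site d L) (φ : Field d L) :
    (modePower p φ : ℂ) = conj (fourier φ p) * fourier φ p := by
  rw [modePower, ← Complex.normSq_eq_norm_sq, Complex.normSq_eq_conj_mul_self]

theorem integrable_modePower_sweep (M P : Matrix (Site d L) (Site d L) ℝ) (φ : Field d L)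
    (p : Site d L) :
    Integrable (fun π => modePower p (M *ᵥ φ + P *ᵥ π)) (momentumLaw d L) := by
  have h := (integrable_conj_fourier_mul_fourier_sweep M P φ p p).re
  simp only [← ofReal_modePower] at h
  simpa using h

/-- The quadratic update matrix in the sector of the mode powers. -/
noncomputable def powerMatrix (m ζ : ℝ) (sites : List (Site d L)) :
    Matrix (Site d L) (Site d L) ℝ :=
  Matrix.of fun p q => ‖momM m ζ sites p q‖ ^ 2

/-- For p = q the momentum delta forces r = s, so mode powers evolve among themselves up to a
constant. -/
theorem transition_modePower (sites : List (Site d L)) (p : Site d L) (φ : Field d L) :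
    transition m ζ sites (modePower p) φ =
      ∑ q, powerMatrix m ζ sites p q * modePower q φ + (avgQuadP m ζ sites p p).re := by
  have h1 : ((transition m ζ sites (modePower p) φ : ℝ) : ℂ) =
      transition m ζ sites (fun ψ => conj (fourier ψ p) * fourier ψ p) φ := by
    simp only [transition, ← ofReal_modePower]
    rw [smul_eq_mul, Complex.real_smul, Complex.ofReal_mul, Complex.ofReal_sum]
    congr 1
    exact Finset.sum_congr rfl fun a _ => integral_ofReal.symm
  have h2 : ∀ r s, avgQuadM m ζ sites (p, p) (r, s) * (conj (fourier φ r) * fourier φ s) =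
      if r = s then ((powerMatrix m ζ sites p r * modePower r φ : ℝ) : ℂ) else 0 := fun r s => by
    rw [avgQuadM_apply]
    simp only [sub_self, eq_comm (a := (0 : Site d L)), sub_eq_zero]
    split_ifs with h
    · subst h
      rw [← Complex.normSq_eq_conj_mul_self, Complex.normSq_eq_norm_sq, ← ofReal_modePower,
        Complex.ofReal_mul]
      rfl
    · simp
  rw [transition_conj_fourier_mul_fourier] at h1
  simp only [h2, Finset.sum_ite_eq, Finset.mem_univ, if_true] at h1
  have := congrArg Complex.re h1
  rw [Complex.add_re, ← Complex.ofReal_sum] at this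
  simpa using this

/-- Linearity rests on integrability of each mode power; the constant is preserved because both
averages are normalized. -/
theorem transition_sum_modePower (sites : List (Site d L)) (c : Site d L → ℝ) (k : ℝ)
    (φ : Field d L) :
    transition m ζ sites (fun ψ => ∑ p, c p * modePower p ψ + k) φ =
      ∑ p, c p * transition m ζ sites (modePower p) φ + k := by
  have hL : ((L : ℝ) ^ d) ≠ 0 := pow_ne_zero _ (NeZero.ne _)
  have hint := fun a p => integrable_modePower_sweep (sweepM m ζ (translate a sites))
    (sweepP m ζ (translate a sites)) φ p
  have h : ∀ a : Site d L, ∫ π : Field d L, (∑ p, c p * modePower p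
      (sweepM m ζ (translate a sites) *ᵥ φ + sweepP m ζ (translate a sites) *ᵥ π) + k)
      ∂(momentumLaw d L) = ∑ p, c p * (∫ π : Field d L, modePower p
        (sweepM m ζ (translate a sites) *ᵥ φ + sweepP m ζ (translate a sites) *ᵥ π)
        ∂(momentumLaw d L)) + k := fun a => by
    rw [integral_add (integrable_finsetSum _ fun p _ => (hint a p).const_mul _)
      (integrable_const _), integral_finsetSum _ fun p _ => (hint a p).const_mul _]
    simp [integral_const_mul]
  simp only [transition, h, smul_eq_mul]
  rw [Finset.sum_add_distrib, mul_add]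
  congr 1
  · rw [Finset.sum_comm, Finset.mul_sum]
    refine Finset.sum_congr rfl fun p _ => ?_
    rw [← Finset.mul_sum]
    ring
  · simp [ZMod.card, hL]

/-- The constant is left unspecified because it cancels in the connected autocorrelation. -/
theorem transition_iterate_modePower (sites : List (Site d L)) (p : Site d L) (t : ℕ) :
    ∃ k : ℝ, (transition m ζ sites)^[t] (modePower p) =
      fun φ => ∑ q, (powerMatrix m ζ sites ^ t) p q * modePower q φ + k := by
  induction t with
  | zero => exact ⟨0, by ext φ; simp [Matrix.one_apply]⟩
  | succ t ih =>
    obtain ⟨k, hk⟩ := ih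
    refine ⟨∑ q, (powerMatrix m ζ sites ^ t) p q * (avgQuadP m ζ sites q q).re + k, ?_⟩
    rw [Function.iterate_succ_apply', hk]
    ext φ
    rw [transition_sum_modePower]
    simp only [transition_modePower, mul_add, Finset.sum_add_distrib]
    rw [add_assoc]
    congr 1
    simp only [pow_succ, Matrix.mul_apply, Finset.sum_mul, Finset.mul_sum]
    rw [Finset.sum_comm]
    simp only [mul_assoc]

theorem modePower_zero : modePower (0 : Site d L) = magSq := by
  ext φ
  have : fourier φ 0 = (magnetization φ : ℂ) := by
    simp only [fourier, Matrix.mulVec, dotProduct, dft_apply, wave_zero_left, map_one, mul_one,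
      ← Finset.mul_sum, magnetization]
    push_cast
    rfl
  rw [modePower, this, magSq, Complex.norm_real, Real.norm_eq_abs, sq_abs]

end Transition

/-! ### Integrability and zero-mode moments of the equilibrium measure. -/

section Equilibrium

variable {d L : ℕ} [NeZero L] {m : ℝ}

/-- The sum of the squares of the field. -/
def sqSum (φ : Field d L) : ℝ := ∑ x, φ x ^ 2

/-- The total field. -/
def fieldSum (φ : Field d L) : ℝ := ∑ x, φ x

theorem sqSum_nonneg (φ : Field d L) : 0 ≤ sqSum φ := Finset.sum_nonneg fun _ _ => sq_nonneg _

theorem sum_add_unitVec (f : Site d L → ℝ) (v : Site d L) : ∑ x, f (x + v) = ∑ x, f x :=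
  Fintype.sum_equiv (Equiv.addRight v) _ _ fun _ => rfl

theorem sum_laplacian (φ : Field d L) : ∑ x, laplacian φ x = 0 := by
  simp only [laplacian]
  rw [Finset.sum_comm]
  refine Finset.sum_eq_zero fun μ _ => ?_
  have h := sum_add_unitVec φ (-unitVec d L μ)
  simp only [← sub_eq_add_neg] at h
  rw [Finset.sum_add_distrib, Finset.sum_sub_distrib, sum_add_unitVec, h, ← Finset.mul_sum]
  ring

/-- Summation by parts turns the sum into minus a sum of squared differences. -/
theorem sum_mul_laplacian_nonpos (φ : Field d L) : ∑ x, φ x * laplacian φ x ≤ 0 := by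
  simp only [laplacian, Finset.mul_sum]
  rw [Finset.sum_comm]
  refine Finset.sum_nonpos fun μ _ => ?_
  have h1 := sum_add_unitVec (fun x => φ x ^ 2) (unitVec d L μ)
  have h2 := sum_add_unitVec (fun x => φ x * φ (x - unitVec d L μ)) (unitVec d L μ)
  simp only [add_sub_cancel_right] at h2
  have h3 : 0 ≤ ∑ x, (φ (x + unitVec d L μ) - φ x) ^ 2 := Finset.sum_nonneg fun _ _ => sq_nonneg _
  have e1 : ∑ x, (φ (x + unitVec d L μ) - φ x) ^ 2 = ∑ x, φ (x + unitVec d L μ) ^ 2 -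
      2 * ∑ x, φ (x + unitVec d L μ) * φ x + ∑ x, φ x ^ 2 := by
    rw [Finset.mul_sum, ← Finset.sum_sub_distrib, ← Finset.sum_add_distrib]
    exact Finset.sum_congr rfl fun x _ => by ring
  have e2 : ∑ x, φ x * (φ (x + unitVec d L μ) - 2 * φ x + φ (x - unitVec d L μ)) =
      ∑ x, φ (x + unitVec d L μ) * φ x - 2 * ∑ x, φ x ^ 2 +
        ∑ x, φ x * φ (x - unitVec d L μ) := by
    rw [Finset.mul_sum, ← Finset.sum_sub_distrib, ← Finset.sum_add_distrib]
    exact Finset.sum_congr rfl fun x _ => by ring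
  rw [e2]
  linarith

theorem le_action (m : ℝ) (φ : Field d L) : m ^ 2 / 2 * sqSum φ ≤ action m φ := by
  have h := sum_mul_laplacian_nonpos φ
  have e : ∑ x, (-(φ x) * laplacian φ x + m ^ 2 * φ x ^ 2) =
      -∑ x, φ x * laplacian φ x + m ^ 2 * sqSum φ := by
    rw [sqSum, Finset.mul_sum, ← Finset.sum_neg_distrib, ← Finset.sum_add_distrib]
    exact Finset.sum_congr rfl fun x _ => by ring
  rw [action, e]
  linarith

theorem fieldSum_add_smul_one (φ : Field d L) (s : ℝ) :
    fieldSum (φ + s • (1 : Field d L)) = fieldSum φ + s * (L : ℝ) ^ d := by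
  simp [fieldSum, Finset.sum_add_distrib, ZMod.card, mul_comm]

/-- Constants are annihilated by the Laplacian, so along the constant field only the mass term
varies. The derivative at s = 0 is m² times the total field. -/
theorem action_add_smul_one (φ : Field d L) (s : ℝ) :
    action m (φ + s • (1 : Field d L)) =
      action m φ + (s * (m ^ 2 * fieldSum φ) + s ^ 2 * (m ^ 2 * (L : ℝ) ^ d / 2)) := by
  have hl : ∀ x, laplacian (φ + s • (1 : Field d L)) x = laplacian φ x := fun x => by
    simp only [laplacian, Pi.add_apply, Pi.smul_apply, Pi.one_apply]
    exact Finset.sum_congr rfl fun μ _ => by ring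
  have hN : ∑ _x : Site d L, (1 : ℝ) = (L : ℝ) ^ d := by simp [ZMod.card]
  have e : ∑ x, (-(φ x + s) * laplacian φ x + m ^ 2 * (φ x + s) ^ 2) =
      ∑ x, (-(φ x) * laplacian φ x + m ^ 2 * φ x ^ 2) - s * ∑ x, laplacian φ x +
        2 * m ^ 2 * s * ∑ x, φ x + m ^ 2 * s ^ 2 * ∑ _x : Site d L, (1 : ℝ) := by
    rw [Finset.mul_sum, Finset.mul_sum, Finset.mul_sum, ← Finset.sum_sub_distrib,
      ← Finset.sum_add_distrib, ← Finset.sum_add_distrib]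
    exact Finset.sum_congr rfl fun x _ => by ring
  rw [sum_laplacian, hN] at e
  simp only [action, hl, Pi.add_apply, Pi.smul_apply, Pi.one_apply, smul_eq_mul, mul_one, e,
    fieldSum]
  ring

theorem continuous_action (m : ℝ) : Continuous (action m : Field d L → ℝ) := by
  unfold action laplacian
  fun_prop

/-- Continuous functions of at most polynomial growth. -/
def PolyBounded (f : Field d L → ℝ) : Prop :=
  Continuous f ∧ ∃ (C : ℝ) (n : ℕ), ∀ φ, |f φ| ≤ C * (1 + sqSum φ) ^ n

theorem PolyBounded.mul {f g : Field d L → ℝ} (hf : PolyBounded f) (hg : PolyBounded g) :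
    PolyBounded fun φ => f φ * g φ := by
  obtain ⟨hf, C, n, hC⟩ := hf
  obtain ⟨hg, D, k, hD⟩ := hg
  refine ⟨hf.mul hg, C * D, n + k, fun φ => ?_⟩
  rw [abs_mul]
  calc _ ≤ (C * (1 + sqSum φ) ^ n) * (D * (1 + sqSum φ) ^ k) :=
        mul_le_mul (hC φ) (hD φ) (abs_nonneg _) ((abs_nonneg _).trans (hC φ))
    _ = _ := by ring

theorem PolyBounded.const (c : ℝ) : PolyBounded fun _ : Field d L => c :=
  ⟨continuous_const, |c|, 0, fun φ => by simp⟩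

theorem PolyBounded.pow {f : Field d L → ℝ} (hf : PolyBounded f) (n : ℕ) :
    PolyBounded fun φ => f φ ^ n := by
  induction n with
  | zero => simpa using PolyBounded.const 1
  | succ n ih => simpa only [pow_succ] using ih.mul hf

theorem sq_fieldSum_le (φ : Field d L) : (∑ x, |φ x|) ^ 2 ≤ (L : ℝ) ^ d * sqSum φ := by
  have h := sq_sum_le_card_mul_sum_sq (s := (Finset.univ : Finset (Site d L))) (f := fun x => |φ x|)
  simpa [ZMod.card, sqSum] using h

theorem polyBounded_fieldSum : PolyBounded (fieldSum : Field d L → ℝ) := by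
  refine ⟨by unfold fieldSum; fun_prop, 1 + (L : ℝ) ^ d, 1, fun φ => ?_⟩
  have h1 := sq_fieldSum_le φ
  have h2 : |fieldSum φ| ≤ ∑ x, |φ x| := Finset.abs_sum_le_sum_abs _ _
  have h3 : (0 : ℝ) ≤ (L : ℝ) ^ d := by positivity
  nlinarith [sqSum_nonneg φ, sq_nonneg (∑ x, |φ x| - 1)]

theorem continuous_fourier (p : Site d L) : Continuous fun φ : Field d L => fourier φ p := by
  simp only [fourier, Matrix.mulVec, dotProduct]
  fun_prop

theorem polyBounded_modePower (p : Site d L) : PolyBounded (modePower p) := by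
  refine ⟨by unfold modePower; exact (continuous_fourier p).norm.pow 2, 1, 1, fun φ => ?_⟩
  have h1 := sq_fieldSum_le φ
  have h2 : ‖fourier φ p‖ ≤ (Real.sqrt ((L : ℝ) ^ d))⁻¹ * ∑ x, |φ x| := by
    simp only [fourier, Matrix.mulVec, dotProduct]
    rw [Finset.mul_sum]
    refine norm_sum_le_of_le _ fun x _ => ?_
    rw [norm_mul, norm_dft, Complex.norm_real, Real.norm_eq_abs]
  have h3 : modePower p φ ≤ sqSum φ := by
    calc modePower p φ ≤ ((Real.sqrt ((L : ℝ) ^ d))⁻¹ * ∑ x, |φ x|) ^ 2 :=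
          pow_le_pow_left₀ (norm_nonneg _) h2 2
      _ ≤ ((L : ℝ) ^ d)⁻¹ * ((L : ℝ) ^ d * sqSum φ) := by
          rw [mul_pow, sqrt_volume_inv_sq]
          gcongr
      _ = sqSum φ := inv_mul_cancel_left₀ (pow_ne_zero _ (NeZero.ne _)) _
  rw [abs_of_nonneg (by unfold modePower; positivity)]
  linarith

theorem integrable_exp_neg_sqSum {b : ℝ} (hb : 0 < b) :
    Integrable fun φ : Field d L => Real.exp (-b * sqSum φ) := by
  have h := Integrable.fintype_prod (ι := Site d L) (μ := fun _ => (volume : Measure ℝ))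
    (f := fun _ y => Real.exp (-b * y ^ 2)) fun _ => integrable_exp_neg_mul_sq hb
  simp only [← Real.exp_sum, ← Finset.mul_sum] at h
  exact h

theorem PolyBounded.integrable_mul_exp (hm : 0 < m) {f : Field d L → ℝ} (hf : PolyBounded f) :
    Integrable fun φ => f φ * Real.exp (-action m φ) := by
  obtain ⟨hf, C, n, hC⟩ := hf
  -- The growth (1 + R)ⁿ is absorbed into ε⁻ⁿ e^{nεR}. With nε ≤ m²/4, half of the decay e^{-m²R/2}
  -- remains.
  set ε : ℝ := min 1 (m ^ 2 / (4 * (n + 1))) with hε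
  have hε0 : 0 < ε := lt_min one_pos (by positivity)
  have hnε : n * ε ≤ m ^ 2 / 4 := by
    have : ε ≤ m ^ 2 / (4 * (n + 1)) := min_le_right _ _
    rw [le_div_iff₀ (by positivity)] at this
    nlinarith
  refine ((integrable_exp_neg_sqSum (d := d) (L := L) (b := m ^ 2 / 4)
    (by positivity)).const_mul (C * ε⁻¹ ^ n)).mono'
    (hf.mul (Real.continuous_exp.comp (continuous_action m).neg)).aestronglyMeasurable
    (ae_of_all _ fun φ => ?_)
  have hR := sqSum_nonneg φ
  have hC0 : 0 ≤ C := by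
    have := (abs_nonneg _).trans (hC 0)
    have h2 : (0 : ℝ) < (1 + sqSum (0 : Field d L)) ^ n := by
      have := sqSum_nonneg (0 : Field d L)
      positivity
    exact nonneg_of_mul_nonneg_left this h2
  have h1 : 1 + sqSum φ ≤ ε⁻¹ * Real.exp (ε * sqSum φ) := by
    rw [← div_eq_inv_mul, le_div_iff₀ hε0]
    have h2 := Real.add_one_le_exp (ε * sqSum φ)
    have h3 : ε ≤ 1 := min_le_left _ _
    nlinarith
  rw [Real.norm_eq_abs, abs_mul, abs_of_pos (Real.exp_pos _)]
  calc |f φ| * Real.exp (-action m φ)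
      ≤ (C * (ε⁻¹ * Real.exp (ε * sqSum φ)) ^ n) * Real.exp (-(m ^ 2 / 2 * sqSum φ)) := by
        refine mul_le_mul ((hC φ).trans ?_) (Real.exp_le_exp.2 (neg_le_neg (le_action m φ)))
          (Real.exp_pos _).le (by positivity)
        gcongr
    _ = C * ε⁻¹ ^ n * Real.exp (n * ε * sqSum φ + -(m ^ 2 / 2 * sqSum φ)) := by
        rw [mul_pow, ← Real.exp_nat_mul, Real.exp_add]
        ring_nf
    _ ≤ _ := by
        refine mul_le_mul_of_nonneg_left (Real.exp_le_exp.2 ?_) (by positivity)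
        nlinarith

theorem integrable_exp_neg_action (hm : 0 < m) :
    Integrable fun φ : Field d L => Real.exp (-action m φ) := by
  simpa using (PolyBounded.const (d := d) (L := L) 1).integrable_mul_exp hm

theorem isProbabilityMeasure_equilibrium (hm : 0 < m) :
    IsProbabilityMeasure (equilibrium d L m) :=
  isProbabilityMeasure_tilted (integrable_exp_neg_action hm)

theorem integral_equilibrium (f : Field d L → ℝ) :
    ∫ φ, f φ ∂(equilibrium d L m) =
      (∫ φ : Field d L, Real.exp (-action m φ))⁻¹ * ∫ φ, f φ * Real.exp (-action m φ) := by
  rw [equilibrium, integral_tilted, ← integral_const_mul]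
  congr 1
  ext φ
  rw [smul_eq_mul]
  ring

theorem PolyBounded.integrable (hm : 0 < m) {f : Field d L → ℝ} (hf : PolyBounded f) :
    Integrable f (equilibrium d L m) := by
  rw [equilibrium, integrable_tilted_iff (integrable_exp_neg_action hm)]
  simpa only [smul_eq_mul, mul_comm] using hf.integrable_mul_exp hm

/-- Integration by parts in the direction of the constant field. -/
theorem integral_fieldSum_pow_mul (hm : 0 < m) (k : ℕ) {f : Field d L → ℝ} (hf : PolyBounded f)
    (hinv : ∀ (φ : Field d L) (s : ℝ), f (φ + s • (1 : Field d L)) = f φ) :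
    m ^ 2 * ∫ φ, fieldSum φ ^ (k + 2) * f φ ∂(equilibrium d L m) =
      (k + 1) * (L : ℝ) ^ d * ∫ φ, fieldSum φ ^ k * f φ ∂(equilibrium d L m) := by
  have hX := polyBounded_fieldSum (d := d) (L := L)
  have i1 := ((hX.pow k).mul hf).integrable_mul_exp hm
  have i2 := ((hX.pow (k + 2)).mul hf).integrable_mul_exp hm
  have i3 := ((hX.pow (k + 1)).mul hf).integrable_mul_exp hm
  have hexp : ∀ φ : Field d L, HasLineDerivAt ℝ (fun φ => Real.exp (-action m φ))
      (-(m ^ 2 * fieldSum φ) * Real.exp (-action m φ)) φ (1 : Field d L) := fun φ => by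
    unfold HasLineDerivAt
    simp only [action_add_smul_one]
    have h1 := (((hasDerivAt_id (0 : ℝ)).mul_const (m ^ 2 * fieldSum φ)).add
      (((hasDerivAt_id (0 : ℝ)).pow 2).mul_const (m ^ 2 * (L : ℝ) ^ d / 2))).const_add (action m φ)
    exact h1.neg.exp.congr_deriv (by simp; ring)
  have hg : ∀ φ : Field d L, HasLineDerivAt ℝ (fun φ => fieldSum φ ^ (k + 1) * f φ)
      ((k + 1) * (L : ℝ) ^ d * (fieldSum φ ^ k * f φ)) φ (1 : Field d L) := fun φ => by
    unfold HasLineDerivAt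
    simp only [fieldSum_add_smul_one, hinv]
    have h1 := ((((hasDerivAt_id (0 : ℝ)).mul_const ((L : ℝ) ^ d)).const_add
      (fieldSum φ)).pow (k + 1)).mul_const (f φ)
    exact h1.congr_deriv (by simp; ring)
  -- The power is k + 1: differentiating it yields the k-th power with factor (k + 1)L^d, while the
  -- exponential yields the (k + 2)-nd with factor -m². The invariant f contributes nothing.
  have key := integral_bilinear_hasLineDerivAt_right_eq_neg_left_of_integrable
    (μ := (volume : Measure (Field d L))) (B := ContinuousLinearMap.mul ℝ ℝ)
    (f := fun φ => fieldSum φ ^ (k + 1) * f φ) (g := fun φ => Real.exp (-action m φ))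
    (v := (1 : Field d L))
    (by simpa only [ContinuousLinearMap.mul_apply', mul_assoc] using
      i1.const_mul ((k + 1) * (L : ℝ) ^ d))
    (by
      have := i2.const_mul (-m ^ 2)
      refine this.congr (ae_of_all _ fun φ => ?_)
      simp only [ContinuousLinearMap.mul_apply']
      ring)
    (by simpa only [ContinuousLinearMap.mul_apply'] using i3)
    (fun φ _ => hg φ) (fun φ _ => hexp φ)
  simp only [ContinuousLinearMap.mul_apply'] at key
  rw [integral_equilibrium, integral_equilibrium]
  have e1 : ∫ φ : Field d L, fieldSum φ ^ (k + 1) * f φ *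
      (-(m ^ 2 * fieldSum φ) * Real.exp (-action m φ)) =
      -m ^ 2 * ∫ φ : Field d L, fieldSum φ ^ (k + 2) * f φ * Real.exp (-action m φ) := by
    rw [← integral_const_mul]
    congr 1
    ext φ
    ring
  have e2 : ∫ φ : Field d L, (k + 1) * (L : ℝ) ^ d * (fieldSum φ ^ k * f φ) *
      Real.exp (-action m φ) =
      (k + 1) * (L : ℝ) ^ d * ∫ φ : Field d L, fieldSum φ ^ k * f φ * Real.exp (-action m φ) := by
    rw [← integral_const_mul]
    congr 1
    ext φ
    ring
  rw [e1, e2] at key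
  linear_combination (-(∫ φ : Field d L, Real.exp (-action m φ))⁻¹) * key

theorem modePower_add_smul_one {p : Site d L} (hp : p ≠ 0) (φ : Field d L) (s : ℝ) :
    modePower p (φ + s • (1 : Field d L)) = modePower p φ := by
  have h : fourier (s • (1 : Field d L)) p = 0 := by
    have h1 := sum_wave (-p)
    rw [if_neg (neg_ne_zero.2 hp)] at h1
    simp only [fourier, Matrix.mulVec, dotProduct, dft_apply, ← wave_neg_left, Pi.smul_apply,
      Pi.one_apply, smul_eq_mul, mul_one]
    rw [← Finset.sum_mul, ← Finset.mul_sum, h1]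
    simp
  rw [modePower, fourier_add, Pi.add_apply, h, add_zero, modePower]

theorem magSq_eq (φ : Field d L) : magSq φ = ((L : ℝ) ^ d)⁻¹ * fieldSum φ ^ 2 := by
  rw [magSq, magnetization, mul_pow, sqrt_volume_inv_sq, fieldSum]

theorem polyBounded_magSq : PolyBounded (magSq : Field d L → ℝ) :=
  modePower_zero (d := d) (L := L) ▸ polyBounded_modePower 0

/-- The case k = 0: a shift-invariant observable is uncorrelated with the squared magnetization. It
is applied to the nonzero modes, so the full Gaussian covariance is never computed. -/
theorem integral_magSq_mul (hm : 0 < m) {f : Field d L → ℝ} (hf : PolyBounded f)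
    (hinv : ∀ (φ : Field d L) (s : ℝ), f (φ + s • (1 : Field d L)) = f φ) :
    ∫ φ, f φ * magSq φ ∂(equilibrium d L m) = (m ^ 2)⁻¹ * ∫ φ, f φ ∂(equilibrium d L m) := by
  have h := integral_fieldSum_pow_mul hm 0 hf hinv
  have hN : ((L : ℝ) ^ d) ≠ 0 := pow_ne_zero _ (NeZero.ne _)
  have e : ∀ φ : Field d L, f φ * magSq φ = ((L : ℝ) ^ d)⁻¹ * (fieldSum φ ^ (0 + 2) * f φ) :=
    fun φ => by rw [magSq_eq]; ring
  simp only [e, integral_const_mul]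
  simp only [pow_zero, one_mul] at h
  push_cast at h
  rw [zero_add, one_mul] at h
  field_simp
  linarith

theorem integral_magSq (hm : 0 < m) : ∫ φ, magSq φ ∂(equilibrium d L m) = (m ^ 2)⁻¹ := by
  have := isProbabilityMeasure_equilibrium (d := d) (L := L) hm
  have h := integral_magSq_mul hm (PolyBounded.const (d := d) (L := L) 1) fun _ _ => rfl
  simpa using h

theorem integral_magSq_sq (hm : 0 < m) :
    ∫ φ, magSq φ ^ 2 ∂(equilibrium d L m) = 3 * (m ^ 2)⁻¹ ^ 2 := by
  -- k = 2 reduces the fourth moment to the second and produces the Gaussian factor 3.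
  have h := integral_fieldSum_pow_mul hm 2 (PolyBounded.const (d := d) (L := L) 1) fun _ _ => rfl
  have h2 := integral_magSq (d := d) (L := L) hm
  have hN : ((L : ℝ) ^ d) ≠ 0 := pow_ne_zero _ (NeZero.ne _)
  have e : ∀ φ : Field d L, magSq φ ^ 2 = ((L : ℝ) ^ d)⁻¹ ^ 2 * fieldSum φ ^ (2 + 2) :=
    fun φ => by rw [magSq_eq]; ring
  simp only [e, integral_const_mul]
  simp only [magSq_eq, integral_const_mul] at h2
  simp only [mul_one] at h
  rw [inv_mul_eq_iff_eq_mul₀ hN] at h2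
  rw [h2] at h
  push_cast at h
  field_simp at h ⊢
  linarith

end Equilibrium

/-! ### The autocorrelation as a matrix element. -/

section Autocorrelation

variable {d L : ℕ} [NeZero L] {m ζ : ℝ}

/-- The covariance with the squared magnetization picks out q = 0 in the iterate. The normalizing
variance is (3 - 1)m⁻⁴, the same 2m⁻⁴ as that covariance. -/
theorem autocorr_magSq (hm : 0 < m) (sites : List (Site d L)) (t : ℕ) :
    autocorr m ζ sites magSq t = (powerMatrix m ζ sites ^ t) 0 0 := by
  have := isProbabilityMeasure_equilibrium (d := d) (L := L) hm
  obtain ⟨k, hk⟩ := transition_iterate_modePower (m := m) (ζ := ζ) sites 0 t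
  rw [modePower_zero] at hk
  set c : Site d L → ℝ := fun q => (powerMatrix m ζ sites ^ t) 0 q with hc
  have hQ := fun q : Site d L => (polyBounded_modePower q).integrable hm
  have hQM := fun q : Site d L => ((polyBounded_modePower q).mul polyBounded_magSq).integrable hm
  have hM := (polyBounded_magSq (d := d) (L := L)).integrable hm
  have e1 : ∫ φ, (∑ q, c q * modePower q φ + k) * magSq φ ∂(equilibrium d L m) =
      ∑ q, c q * ∫ φ, modePower q φ * magSq φ ∂(equilibrium d L m) + k * (m ^ 2)⁻¹ := by
    simp only [add_mul, Finset.sum_mul, mul_assoc]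
    rw [integral_add (integrable_finsetSum _ fun q _ => (hQM q).const_mul _) (hM.const_mul k),
      integral_finsetSum _ fun q _ => (hQM q).const_mul _]
    simp only [integral_const_mul, integral_magSq hm]
  have e2 : ∫ φ, (∑ q, c q * modePower q φ + k) ∂(equilibrium d L m) =
      ∑ q, c q * ∫ φ, modePower q φ ∂(equilibrium d L m) + k := by
    rw [integral_add (integrable_finsetSum _ fun q _ => (hQ q).const_mul _) (integrable_const k),
      integral_finsetSum _ fun q _ => (hQ q).const_mul _]
    simp [integral_const_mul]
  have e3 : ∀ q, ∫ φ, modePower q φ * magSq φ ∂(equilibrium d L m) -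
      (∫ φ, modePower q φ ∂(equilibrium d L m)) * (m ^ 2)⁻¹ =
        if q = 0 then 2 * (m ^ 2)⁻¹ ^ 2 else 0 := fun q => by
    split_ifs with hq
    · subst hq
      simp only [modePower_zero, ← sq, integral_magSq_sq hm, integral_magSq hm]
      ring
    · rw [integral_magSq_mul hm (polyBounded_modePower q) (modePower_add_smul_one hq)]
      ring
  rw [autocorr, hk, e1, e2, integral_magSq_sq hm, integral_magSq hm]
  have e4 : ∑ q, c q * ∫ φ, modePower q φ * magSq φ ∂(equilibrium d L m) + k * (m ^ 2)⁻¹ -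
      (∑ q, c q * ∫ φ, modePower q φ ∂(equilibrium d L m) + k) * (m ^ 2)⁻¹ =
      c 0 * (2 * (m ^ 2)⁻¹ ^ 2) := by
    have : ∑ q, c q * (∫ φ, modePower q φ * magSq φ ∂(equilibrium d L m) -
      (∫ φ, modePower q φ ∂(equilibrium d L m)) * (m ^ 2)⁻¹) = c 0 * (2 * (m ^ 2)⁻¹ ^ 2) := by
      simp only [e3]
      simp
    rw [← this]
    simp only [mul_sub, Finset.sum_sub_distrib, ← mul_assoc, ← Finset.sum_mul, add_mul]
    ring
  rw [e4, hc]
  have hm2 : (m ^ 2)⁻¹ ≠ 0 := by positivity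
  field_simp
  norm_num

end Autocorrelation

/-! ### Neumann series of a nonnegative matrix decreasing a positive vector. -/

section PositiveMatrices

variable {n : Type*} [Fintype n] [DecidableEq n] [Nonempty n] {A : Matrix n n ℝ} {v : n → ℝ}

/-- Finiteness of the index set makes the strict decrease uniform: ρ is the largest of the ratios
(Av)_p / v_p. -/
theorem exists_lt_one_mulVec_le (hA : ∀ p q, 0 ≤ A p q) (hv : ∀ p, 0 < v p)
    (h : ∀ p, ∑ q, A p q * v q < v p) :
    ∃ ρ : ℝ, 0 ≤ ρ ∧ ρ < 1 ∧ ∀ p, ∑ q, A p q * v q ≤ ρ * v p := by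
  obtain ⟨p₀, -, hp₀⟩ := Finset.exists_max_image Finset.univ
    (fun p => (∑ q, A p q * v q) / v p) Finset.univ_nonempty
  refine ⟨(∑ q, A p₀ q * v q) / v p₀, div_nonneg (Finset.sum_nonneg fun q _ =>
    mul_nonneg (hA _ _) (hv q).le) (hv _).le, (div_lt_one (hv _)).2 (h _), fun p => ?_⟩
  exact (div_le_iff₀ (hv p)).1 (hp₀ p (Finset.mem_univ p))

/-- A contracts by ρ in the sup norm weighted by v, whence (Aᵗ)_pq ≤ ρᵗ v_p / v_q. -/
theorem summable_pow_apply (hA : ∀ p q, 0 ≤ A p q) (hv : ∀ p, 0 < v p)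
    (h : ∀ p, ∑ q, A p q * v q < v p) (p q : n) : Summable fun t : ℕ => (A ^ t) p q := by
  obtain ⟨ρ, hρ0, hρ1, hρ⟩ := exists_lt_one_mulVec_le hA hv h
  have hpow : ∀ (t : ℕ) (p q : n), 0 ≤ (A ^ t) p q := fun t => by
    induction t with
    | zero =>
      intro p q
      rw [pow_zero, Matrix.one_apply]
      split_ifs <;> norm_num
    | succ t ih =>
      intro p q
      rw [pow_succ, Matrix.mul_apply]
      exact Finset.sum_nonneg fun r _ => mul_nonneg (ih p r) (hA r q)
  have hb : ∀ (t : ℕ) (p : n), ∑ q, (A ^ t) p q * v q ≤ ρ ^ t * v p := fun t => by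
    induction t with
    | zero => intro p; simp [Matrix.one_apply]
    | succ t ih =>
      intro p
      calc ∑ q, (A ^ (t + 1)) p q * v q = ∑ r, (A ^ t) p r * ∑ q, A r q * v q := by
            simp only [pow_succ, Matrix.mul_apply, Finset.sum_mul, Finset.mul_sum, mul_assoc]
            exact Finset.sum_comm
        _ ≤ ∑ r, (A ^ t) p r * (ρ * v r) :=
            Finset.sum_le_sum fun r _ => mul_le_mul_of_nonneg_left (hρ r) (hpow t p r)
        _ = ρ * ∑ r, (A ^ t) p r * v r := by
            rw [Finset.mul_sum]
            exact Finset.sum_congr rfl fun r _ => by ring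
        _ ≤ ρ * (ρ ^ t * v p) := mul_le_mul_of_nonneg_left (ih p) hρ0
        _ = _ := by ring
  refine Summable.of_nonneg_of_le (fun t => hpow t p q) (fun t => ?_)
    ((summable_geometric_of_lt_one hρ0 hρ1).mul_right (v p / v q))
  rw [← mul_div_assoc, le_div_iff₀ (hv q)]
  exact (Finset.single_le_sum (f := fun q => (A ^ t) p q * v q)
    (fun r _ => mul_nonneg (hpow t p r) (hv r).le) (Finset.mem_univ q)).trans (hb t p)

theorem one_sub_mul_tsum_pow (hA : ∀ p q, 0 ≤ A p q) (hv : ∀ p, 0 < v p)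
    (h : ∀ p, ∑ q, A p q * v q < v p) :
    (1 - A) * Matrix.of (fun p q => ∑' t : ℕ, (A ^ t) p q) = 1 := by
  have hs := summable_pow_apply hA hv h
  ext p q
  rw [Matrix.sub_mul, one_mul, Matrix.sub_apply, Matrix.mul_apply]
  simp only [Matrix.of_apply]
  have e : ∑ r, A p r * ∑' t : ℕ, (A ^ t) r q = ∑' t : ℕ, (A ^ (t + 1)) p q := by
    simp only [pow_succ', Matrix.mul_apply, ← tsum_mul_left]
    rw [Summable.tsum_finsetSum fun r _ => (hs r q).mul_left _]
  rw [e, (hs p q).tsum_eq_zero_add, pow_zero, add_sub_cancel_right]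

end PositiveMatrices

/-! ### Summed autocorrelation and the bound on the difference of inverses. -/

section IntegratedAutocorrelation

variable {d L : ℕ} [NeZero L] {m ζ : ℝ} {sites : List (Site d L)}

theorem absSq_momM_eq (m ζ : ℝ) (sites : List (Site d L)) :
    absSq (momM m ζ sites) = (powerMatrix m ζ sites).map (fun r : ℝ => (r : ℂ)) := by
  ext p q
  rw [absSq_apply]
  rfl

theorem powerMatrix_nonneg (p q : Site d L) : 0 ≤ powerMatrix m ζ sites p q :=
  sq_nonneg ‖momM m ζ sites p q‖

/-- The positive vector is the free covariance, strictly decreased by `sum_normSq_momM_lt`. -/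
theorem summable_powerMatrix (hm : 0 < m) (hζ0 : 0 < ζ) (hζ2 : ζ < 2) (hL : 2 ≤ L)
    (hn : sites.Nodup) (hc : ∀ x, x ∈ sites) (p q : Site d L) :
    Summable fun t : ℕ => (powerMatrix m ζ sites ^ t) p q :=
  summable_pow_apply (v := fun p => (invCovEig m p)⁻¹) powerMatrix_nonneg
    (fun p => inv_pos.2 (invCovEig_pos hm p)) (sum_normSq_momM_lt hm hζ0 hζ2 hL hn hc) p q

theorem one_sub_absSq_momM_mul (hm : 0 < m) (hζ0 : 0 < ζ) (hζ2 : ζ < 2) (hL : 2 ≤ L)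
    (hn : sites.Nodup) (hc : ∀ x, x ∈ sites) :
    (1 - absSq (momM m ζ sites)) *
      Matrix.of (fun p q => ((∑' t : ℕ, (powerMatrix m ζ sites ^ t) p q : ℝ) : ℂ)) = 1 := by
  have h := one_sub_mul_tsum_pow (A := powerMatrix m ζ sites)
    (v := fun p => (invCovEig m p)⁻¹) powerMatrix_nonneg
    (fun p => inv_pos.2 (invCovEig_pos hm p)) (sum_normSq_momM_lt hm hζ0 hζ2 hL hn hc)
  have h2 := congrArg Complex.ofRealHom.mapMatrix h
  rw [map_mul, map_sub, map_one] at h2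
  rw [absSq_momM_eq]
  exact h2

theorem isUnit_one_sub_absSq_momM (hm : 0 < m) (hζ0 : 0 < ζ) (hζ2 : ζ < 2) (hL : 2 ≤ L)
    (hn : sites.Nodup) (hc : ∀ x, x ∈ sites) : IsUnit (1 - absSq (momM m ζ sites)) :=
  IsUnit.of_mul_eq_one _ (one_sub_absSq_momM_mul hm hζ0 hζ2 hL hn hc)

theorem summable_autocorr_magSq (hm : 0 < m) (hζ0 : 0 < ζ) (hζ2 : ζ < 2) (hL : 2 ≤ L)
    (hn : sites.Nodup) (hc : ∀ x, x ∈ sites) :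
    Summable fun t : ℕ => autocorr m ζ sites magSq (t + 1) := by
  simp only [autocorr_magSq hm]
  exact (summable_nat_add_iff (f := fun t => (powerMatrix m ζ sites ^ t) 0 0) 1).2
    (summable_powerMatrix hm hζ0 hζ2 hL hn hc 0 0)

theorem one_add_intAutocorr (hm : 0 < m) (hζ0 : 0 < ζ) (hζ2 : ζ < 2) (hL : 2 ≤ L)
    (hn : sites.Nodup) (hc : ∀ x, x ∈ sites) :
    ((1 + intAutocorr m ζ sites : ℝ) : ℂ) = (1 - absSq (momM m ζ sites))⁻¹ 0 0 := by
  rw [Matrix.inv_eq_right_inv (one_sub_absSq_momM_mul hm hζ0 hζ2 hL hn hc), Matrix.of_apply,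
    (summable_powerMatrix hm hζ0 hζ2 hL hn hc 0 0).tsum_eq_zero_add, intAutocorr]
  simp only [autocorr_magSq hm]
  simp

/-- The finite-volume correction to the quadratic resolvent is of order `1 / L`. -/
theorem norm_inv_sub_inv_absSq_le (d : ℕ) (hm : 0 < m) (hζ0 : 0 < ζ) (hζ2 : ζ < 2) :
    ∃ (C : ℝ) (L₀ : ℕ), 2 ≤ L₀ ∧ ∀ (L : ℕ) [NeZero L], L₀ ≤ L →
      ∀ (start : Site d L) (sites : List (Site d L)), IsLexSweep start sites →
        ‖(1 - absSq (momM m ζ sites))⁻¹ - (1 - absSq (momMD d L m ζ))⁻¹‖ ≤ C / L := by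
  obtain ⟨C, hC0, hC⟩ := norm_absSq_sub_le d hm hζ0 hζ2
  set κ : ℝ := 4 / ((2 - ζ) * (ζ / siteFreqSq d m) * m ^ 2) with hκ
  -- L₀ is chosen so that ε = C/L satisfies εκ ≤ 1/2; the constant is L times the resulting bound
  -- 2κεκ.
  refine ⟨2 * κ * C * κ, max 2 ⌈2 * C * κ⌉₊, le_max_left _ _, fun L _ hL start sites h => ?_⟩
  have hL2 : 2 ≤ L := (le_max_left _ _).trans hL
  have hLpos : (0 : ℝ) < L := by exact_mod_cast (NeZero.pos L)
  have hLC : 2 * C * κ ≤ L :=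
    (Nat.le_ceil _).trans (by exact_mod_cast (le_max_right _ _).trans hL)
  have hdiff : ‖(1 - absSq (momM m ζ sites)) - (1 - absSq (momMD d L m ζ))‖ ≤ C / L := by
    rw [sub_sub_sub_cancel_left, norm_sub_rev]
    exact hC L hL2 start sites h
  have hs : C / L * κ ≤ 1 / 2 := by
    rw [div_mul_eq_mul_div, div_le_iff₀ hLpos]
    linarith
  refine (norm_inv_sub_inv_le (isUnit_one_sub_absSq_momM hm hζ0 hζ2 hL2 h.nodup h.complete)
    (isUnit_one_sub_absSq_momMD hm hζ0 hζ2) (norm_inv_one_sub_absSq_momMD_le hm hζ0 hζ2)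
    hdiff hs).trans (le_of_eq ?_)
  ring

theorem norm_apply_le_norm {n : Type*} [Fintype n] (A : Matrix n n ℂ) (p q : n) :
    ‖A p q‖ ≤ ‖A‖ := by
  rw [Matrix.linfty_opNorm_def]
  have h : ∑ j, ‖A p j‖₊ ≤ Finset.univ.sup fun i => ∑ j, ‖A i j‖₊ :=
    Finset.le_sup (f := fun i => ∑ j, ‖A i j‖₊) (Finset.mem_univ p)
  have h2 : ‖A p q‖₊ ≤ ∑ j, ‖A p j‖₊ :=
    Finset.single_le_sum (f := fun j => ‖A p j‖₊) (fun _ _ => zero_le) (Finset.mem_univ q)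
  exact_mod_cast h2.trans h

end IntegratedAutocorrelation

end LHMC

/-! ### Assembly of the claims. -/

theorem mainTheorem3 (d : ℕ) (m ζ : ℝ) (hm : 0 < m) (hζ0 : 0 < ζ) (hζ2 : ζ < 2) :
    (∀ (L : ℕ) [NeZero L], 2 ≤ L →
      ∀ (start : LHMC.Site d L) (sites : List (LHMC.Site d L)), LHMC.IsLexSweep start sites →
        -- the averaged quadratic update of a randomized sweep
        (∀ (φ : LHMC.Field d L) (p q : LHMC.Site d L),
          LHMC.transition m ζ sites
              (fun ψ => conj (LHMC.fourier ψ p) * LHMC.fourier ψ q) φ =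
            (∑ r : LHMC.Site d L, ∑ s : LHMC.Site d L,
              LHMC.avgQuadM m ζ sites (p, q) (r, s) *
                (conj (LHMC.fourier φ r) * LHMC.fourier φ s)) +
            LHMC.avgQuadP m ζ sites p q) ∧
        (∀ p q r s : LHMC.Site d L,
          LHMC.avgQuadM m ζ sites (p, q) (r, s) =
            if p - q = r - s then
              conj (LHMC.momM m ζ sites p r) * LHMC.momM m ζ sites q s
            else 0) ∧
        LHMC.sectorBlock m ζ sites = LHMC.absSq (LHMC.momM m ζ sites) ∧
        -- the inverses below are genuine, and the autocorrelation is the matrix element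
        IsUnit (1 - LHMC.absSq (LHMC.momM m ζ sites)) ∧
        IsUnit (1 - LHMC.absSq (LHMC.momMD d L m ζ)) ∧
        Summable (fun t : ℕ => LHMC.autocorr m ζ sites LHMC.magSq (t + 1)) ∧
        ((1 + LHMC.intAutocorr m ζ sites : ℝ) : ℂ) =
          (1 - LHMC.absSq (LHMC.momM m ζ sites))⁻¹ 0 0 ∧
        (1 - LHMC.absSq (LHMC.momMD d L m ζ))⁻¹ 0 0 =
          (LHMC.infiniteVolumeValue d m ζ : ℂ)) ∧
    -- the finite-volume bound in the maximum row sum norm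
    (∃ (C : ℝ) (L₀ : ℕ), ∀ (L : ℕ) [NeZero L], L₀ ≤ L →
      ∀ (start : LHMC.Site d L) (sites : List (LHMC.Site d L)), LHMC.IsLexSweep start sites →
        ‖(1 - LHMC.absSq (LHMC.momM m ζ sites))⁻¹ -
          (1 - LHMC.absSq (LHMC.momMD d L m ζ))⁻¹‖ ≤ C / L) ∧
    -- the infinite-volume limit
    (∀ (start : ∀ n : ℕ, LHMC.Site d (n + 1)) (sites : ∀ n : ℕ, List (LHMC.Site d (n + 1))),
      (∀ n : ℕ, LHMC.IsLexSweep (start n) (sites n)) →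
        Tendsto (fun n : ℕ => 1 + LHMC.intAutocorr m ζ (sites n)) atTop
          (𝓝 (LHMC.infiniteVolumeValue d m ζ))) := by
  refine ⟨fun L _ hL start sites h => ⟨LHMC.transition_conj_fourier_mul_fourier sites,
    LHMC.avgQuadM_apply sites, LHMC.sectorBlock_eq sites,
    LHMC.isUnit_one_sub_absSq_momM hm hζ0 hζ2 hL h.nodup h.complete,
    LHMC.isUnit_one_sub_absSq_momMD hm hζ0 hζ2,
    LHMC.summable_autocorr_magSq hm hζ0 hζ2 hL h.nodup h.complete,
    LHMC.one_add_intAutocorr hm hζ0 hζ2 hL h.nodup h.complete,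
    LHMC.inv_one_sub_absSq_momMD_zero hm hζ0 hζ2⟩, ?_, fun start sites h => ?_⟩
  · obtain ⟨C, L₀, -, hC⟩ := LHMC.norm_inv_sub_inv_absSq_le d hm hζ0 hζ2
    exact ⟨C, L₀, hC⟩
  · obtain ⟨C, L₀, hL₀, hC⟩ := LHMC.norm_inv_sub_inv_absSq_le d hm hζ0 hζ2
    have hlim : Tendsto (fun n : ℕ => C / ((n + 1 : ℕ) : ℝ)) atTop (𝓝 0) :=
      (tendsto_const_div_atTop_nhds_zero_nat C).comp (tendsto_add_atTop_nat 1)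
    rw [tendsto_iff_norm_sub_tendsto_zero]
    refine squeeze_zero' (Eventually.of_forall fun n => norm_nonneg _) ?_ hlim
    -- The n-th volume is L = n + 1, and L₀ ≥ 2 excludes L = 1. The deviation is then the (0,0)
    -- entry of the difference of inverses, bounded by its row-sum norm.
    filter_upwards [eventually_ge_atTop L₀] with n hn
    rw [← Complex.norm_real, Complex.ofReal_sub,
      LHMC.one_add_intAutocorr hm hζ0 hζ2 (by omega) (h n).nodup (h n).complete,
      ← LHMC.inv_one_sub_absSq_momMD_zero (L := n + 1) hm hζ0 hζ2, ← Matrix.sub_apply]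
    exact (LHMC.norm_apply_le_norm _ 0 0).trans (hC (n + 1) (by omega) (start n) (sites n) (h n))
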